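/- **Conventions.** Let $M$ be a smooth (finite-dimensional, Hausdorff, second countable) manifold without boundary; all tensor fields are smooth. For a bivector $\pi$ define $\pi^\sharp:T^*M\to TM$ by $\langle\beta,\pi^\sharp\alpha\rangle=\pi(\alpha,\beta)$ and put $\{f,g\}=\langle df,\pi^\sharp dg\rangle$; $\pi$ is Poisson if $\{\cdot,\cdot\}$ satisfies the Jacobi identity. For a $(1,1)$ tensor field $N:TM\to TM$ let $N^*$ be its transpose, $T_N(X,Y)=[NX,NY]-N([NX,Y]+[X,NY]-N[X,Y])$ its Nijenhuis torsion, $i_N\alpha(X_1,\dots,X_p)=\sum_i\alpha(X_1,\dots,NX_i,\dots,X_p)$ for a $p$-form $\alpha$, and $d_N=i_N\circ d-d\circ i_N$. Then $(M,\pi,N)$ is a Poisson–Nijenhuis manifold if $\pi$ is Poisson, $T_N=0$, $N\pi^\sharp=\pi^\sharp N^*$, and $L_{\pi^\sharp\alpha}(N)X-\pi^\sharp L_X(N^*\alpha)+\pi^\sharp L_{NX}\alpha=0$ for all 1-forms $\alpha$ and vector fields $X$. Let $[\cdot,\cdot]_\pi$ be the Koszul bracket of differential forms, i.e. the extension, as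 a graded derivation of the wedge product in each entry, of $[\alpha,f]_\pi=\langle df,\pi^\sharp\alpha\rangle$ and of $[\alpha,\beta]_\pi=L_{\pi^\sharp\alpha}\beta-L_{\pi^\sharp\beta}\alpha-d\langle\beta,\pi^\sharp\alpha\rangle$ ($\alpha,\beta$ 1-forms, $f$ a function), with $[\eta,\eta']_\pi=-(-1)^{(q-1)(q'-1)}[\eta',\eta]_\pi$ for a $q$-form $\eta$ and a $q'$-form $\eta'$. For a 2-form $\Omega$ put $\Omega^\flat(X)=i_X\Omega=\Omega(X,\cdot)$. **Theorem 4.2.** Let $(M,\pi,N)$ be a Poisson–Nijenhuis manifold and let $\Omega$ be a closed 2-form on $M$. Put $$N_\pm=N\pm\pi^\sharp\Omega^\flat,\qquad \phi_+=d_N\Omega+\tfrac12[\Omega,\Omega]_\pi,\qquad H_k^+=\tfrac1{2k}\operatorname{Tr}(N_+^k),\qquad X_k^+=\pi^\sharp\,dH_k^+,\qquad Y_k^+=N_+^{k-1}X_1^+-X_k^+\qquad(k\ge1).$$ Suppose that * $(a')$ $\phi_+=-2\,dH_1^+\wedge\Omega$; * $(b')$ $\Omega^\flat(Y_k^+)=0$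 for all $k\ge1$. Then * (i) the functions $H_k^+$ form a generalized Lenard–Magri chain with respect to $N_-$: for all $k\ge1$, $$N_-^*\,dH_k^+=dH_{k+1}^++f_k\,dH_1^+,\qquad f_k=-\operatorname{Tr}\left(N_+^{k-1}\pi^\sharp\Omega^\flat\right);$$ * (ii) $\{H_j^+,H_k^+\}=0$ for all $j,k\ge1$. -/

import Mathlib

open scoped Manifold ContDiff

noncomputable section

namespace PqN

/-! ### Linear algebra on a single vector space -/

section Pointwise

/-- The vector `P^♯ α` attached to a bivector `P` (a bilinear form on the dual space) and a
covector `α`; it is characterised by `⟨β, P^♯ α⟩ = P(α, β)`. -/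
def sharp {V : Type*} [AddCommGroup V] [Module ℝ V] [FiniteDimensional ℝ V]
    (P : LinearMap.BilinForm ℝ (Module.Dual ℝ V)) : Module.Dual ℝ V →ₗ[ℝ] V :=
  (Module.evalEquiv ℝ V).symm.toLinearMap ∘ₗ P

theorem apply_sharp {V : Type*} [AddCommGroup V] [Module ℝ V] [FiniteDimensional ℝ V]
    (P : LinearMap.BilinForm ℝ (Module.Dual ℝ V)) (α β : Module.Dual ℝ V) :
    β (sharp P α) = P α β := by
  simp [sharp]

/-- The map `θ^♭ : V → V^*`, `θ^♭(v) = θ(v, ·)`, of an alternating 2-form. -/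
def flat {V : Type*} [AddCommGroup V] [Module ℝ V] (θ : V [⋀^Fin 2]→ₗ[ℝ] ℝ) :
    V →ₗ[ℝ] Module.Dual ℝ V :=
  LinearMap.mk₂ ℝ (fun v w => θ ![v, w])
    (fun v v' w => by simpa using θ.map_vecCons_add ![w] v v')
    (fun c v w => by simpa using θ.map_vecCons_smul ![w] c v)
    (fun v w w' => by
      have h := θ.map_update_add ![v, 0] 1 w w'
      have e : ∀ u : V, Function.update ![v, 0] 1 u = ![v, u] := fun u => by
        ext i; fin_cases i <;> simp
      simpa only [e] using h)
    (fun c v w => by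
      have h := θ.map_update_smul ![v, 0] 1 c w
      have e : ∀ u : V, Function.update ![v, 0] 1 u = ![v, u] := fun u => by
        ext i; fin_cases i <;> simp
      simpa only [e] using h)

/-- A covector, seen as an alternating 1-form. -/
def ofCovector {V : Type*} [AddCommGroup V] [Module ℝ V] (α : Module.Dual ℝ V) :
    V [⋀^Fin 1]→ₗ[ℝ] ℝ :=
  AlternatingMap.ofSubsingleton ℝ V ℝ (0 : Fin 1) α

/-- The wedge product of alternating forms,
`(a ∧ b)(v₁, …, v_{p+q}) = ∑ sgn(σ) a(v_{σ(1)}, …, v_{σ(p)}) b(v_{σ(p+1)}, …, v_{σ(p+q)})`,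
the sum being over the `(p, q)`-shuffles `σ`. -/
def wedgeAlt {V : Type*} [AddCommGroup V] [Module ℝ V] {p q : ℕ}
    (a : V [⋀^Fin p]→ₗ[ℝ] ℝ) (b : V [⋀^Fin q]→ₗ[ℝ] ℝ) : V [⋀^Fin (p + q)]→ₗ[ℝ] ℝ :=
  ((LinearMap.mul' ℝ ℝ).compAlternatingMap (a.domCoprod b)).domDomCongr finSumFinEquiv

theorem insertEnd_aux {V : Type*} [AddCommGroup V] [Module ℝ V] {p : ℕ}
    (A : Module.End ℝ V) (a : V [⋀^Fin p]→ₗ[ℝ] ℝ) (v : Fin p → V) :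
    ∑ i : Fin p, a (Function.update v i (A (v i)))
      = (∑ i : Fin p, a.toMultilinearMap.compLinearMap
          (fun j => if j = i then A else LinearMap.id)) v := by
  rw [sum_apply]
  refine Finset.sum_congr rfl fun i _ => ?_
  rw [MultilinearMap.compLinearMap_apply]
  change a _ = a _
  congr 1
  funext j
  by_cases h : j = i
  · subst h
    simp
  · simp [h]

/-- The form `i_A a (v₁, …, v_p) = ∑ i, a(v₁, …, A v_i, …, v_p)`, for an endomorphism `A`. -/
def insertEndAlt {V : Type*} [AddCommGroup V] [Module ℝ V] {p : ℕ}
    (A : Module.End ℝ V) (a : V [⋀^Fin p]→ₗ[ℝ] ℝ) : V [⋀^Fin p]→ₗ[ℝ] ℝ :=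
  { toFun := fun v => ∑ i : Fin p, a (Function.update v i (A (v i)))
    map_update_add' := fun {inst} v i x y => by
      obtain rfl : inst = instDecidableEqFin p := Subsingleton.elim _ _
      simp only [insertEnd_aux]
      exact (∑ i : Fin p, a.toMultilinearMap.compLinearMap
        (fun j => if j = i then A else LinearMap.id)).map_update_add v i x y
    map_update_smul' := fun {inst} v i c x => by
      obtain rfl : inst = instDecidableEqFin p := Subsingleton.elim _ _
      simp only [insertEnd_aux]
      exact (∑ i : Fin p, a.toMultilinearMap.compLinearMap
        (fun j => if j = i then A else LinearMap.id)).map_update_smul v i c x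
    map_eq_zero_of_eq' := fun v i j hv hij => by
      rw [Finset.sum_eq_add i j hij]
      · have h := a.map_swap (Function.update v i (A (v i))) hij
        have e : Function.update v i (A (v i)) ∘ Equiv.swap i j
            = Function.update v j (A (v j)) := by
          funext l
          by_cases h1 : l = i
          · subst h1
            simp [Function.update_of_ne hij, Function.update_of_ne hij.symm, hv]
          · by_cases h2 : l = j
            · subst h2
              simp [hv]
            · simp [Equiv.swap_apply_of_ne_of_ne h1 h2, h1, h2]
        rw [e] at h
        rw [h]
        simp
      · intro l _ hl
        refine a.map_eq_zero_of_eq _ ?_ hij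
        rw [Function.update_of_ne hl.1.symm, Function.update_of_ne hl.2.symm, hv]
      · simp
      · simp }

/-- The contraction of a form with a bivector `P`: if `P = ½ ∑ P^{ij} e_i ∧ e_j`, then
`i_P a = ½ ∑ P^{ij} a(e_i, e_j, ·, …, ·) = ½ ∑ i, a(e_i, P^♯ e^i, ·, …, ·)`,
so that `i_P (α ∧ β) = P(α, β)` for covectors `α` and `β`. -/
def insertBivectorAlt {V : Type*} [AddCommGroup V] [Module ℝ V] [FiniteDimensional ℝ V] {p : ℕ}
    (P : LinearMap.BilinForm ℝ (Module.Dual ℝ V)) (a : V [⋀^Fin (p + 2)]→ₗ[ℝ] ℝ) :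
    V [⋀^Fin p]→ₗ[ℝ] ℝ :=
  (1 / 2 : ℝ) • ∑ i, (a.curryLeft (Module.finBasis ℝ V i)).curryLeft
    (sharp P ((Module.finBasis ℝ V).coord i))

/-- Alternating forms on a finite dimensional space are continuous. -/
theorem continuous_alt {E : Type*} [NormedAddCommGroup E] [NormedSpace ℝ E]
    [FiniteDimensional ℝ E] {p : ℕ} (a : E [⋀^Fin p]→ₗ[ℝ] ℝ) :
    Continuous (fun v : Fin p → E => a v) := by
  have h : ∀ v : Fin p → E, a v = ∑ r : Fin p → Fin (Module.finrank ℝ E),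
      (∏ i, (Module.finBasis ℝ E).coord (r i) (v i)) • a (fun i => Module.finBasis ℝ E (r i)) := by
    intro v
    have hv : v = fun i => ∑ j, (Module.finBasis ℝ E).coord j (v i) • Module.finBasis ℝ E j := by
      funext i
      simp only [Module.Basis.coord_apply]
      exact ((Module.finBasis ℝ E).sum_repr (v i)).symm
    conv_lhs => rw [hv]
    have h1 := a.toMultilinearMap.map_sum
      (fun i j => (Module.finBasis ℝ E).coord j (v i) • Module.finBasis ℝ E j)
    refine h1.trans (Finset.sum_congr rfl fun r _ => ?_)
    exact a.toMultilinearMap.map_smul_univ _ _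
  rw [funext h]
  refine continuous_finsetSum _ fun r _ => ?_
  have hc : Continuous (fun v : Fin p → E =>
      ∏ i, (Module.finBasis ℝ E).coord (r i) (v i)) :=
    continuous_finsetProd _ fun i _ =>
      (LinearMap.continuous_of_finiteDimensional ((Module.finBasis ℝ E).coord (r i))).comp
        (continuous_apply i)
  exact hc.smul continuous_const

/-- An alternating form on a finite dimensional space, as a continuous alternating form. -/
def toCont {E : Type*} [NormedAddCommGroup E] [NormedSpace ℝ E] [FiniteDimensional ℝ E] {p : ℕ}
    (a : E [⋀^Fin p]→ₗ[ℝ] ℝ) : E [⋀^Fin p]→L[ℝ] ℝ :=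
  { a with cont := continuous_alt a }

end Pointwise

/-! ### Fields on a manifold `M` modelled on a finite dimensional real vector space `E` -/

section Manifold

instance instFiniteDimensionalTangentSpace {E : Type*} [NormedAddCommGroup E] [NormedSpace ℝ E]
    [FiniteDimensional ℝ E] {M : Type*} [TopologicalSpace M] [ChartedSpace E M] (x : M) :
    FiniteDimensional ℝ (TangentSpace 𝓘(ℝ, E) x) :=
  inferInstanceAs (FiniteDimensional ℝ E)

/-- (Not necessarily smooth) vector fields. -/
abbrev VField (E : Type*) [NormedAddCommGroup E] [NormedSpace ℝ E]
    (M : Type*) [TopologicalSpace M] [ChartedSpace E M] :=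
  Π x : M, TangentSpace 𝓘(ℝ, E) x

/-- (Not necessarily smooth) 1-forms, as fields of covectors. -/
abbrev CovField (E : Type*) [NormedAddCommGroup E] [NormedSpace ℝ E]
    (M : Type*) [TopologicalSpace M] [ChartedSpace E M] :=
  Π x : M, Module.Dual ℝ (TangentSpace 𝓘(ℝ, E) x)

/-- (Not necessarily smooth) `p`-forms. -/
abbrev Form (E : Type*) [NormedAddCommGroup E] [NormedSpace ℝ E]
    (M : Type*) [TopologicalSpace M] [ChartedSpace E M] (p : ℕ) :=
  Π x : M, (TangentSpace 𝓘(ℝ, E) x) [⋀^Fin p]→ₗ[ℝ] ℝ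

/-- (Not necessarily smooth) tensor fields of type (1,1). -/
abbrev EndField (E : Type*) [NormedAddCommGroup E] [NormedSpace ℝ E]
    (M : Type*) [TopologicalSpace M] [ChartedSpace E M] :=
  Π x : M, Module.End ℝ (TangentSpace 𝓘(ℝ, E) x)

/-- (Not necessarily smooth or skew-symmetric) contravariant tensor fields of order two. -/
abbrev BivField (E : Type*) [NormedAddCommGroup E] [NormedSpace ℝ E]
    (M : Type*) [TopologicalSpace M] [ChartedSpace E M] :=
  Π x : M, LinearMap.BilinForm ℝ (Module.Dual ℝ (TangentSpace 𝓘(ℝ, E) x))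

variable {E : Type*} [NormedAddCommGroup E] [NormedSpace ℝ E]
  {M : Type*} [TopologicalSpace M] [ChartedSpace E M]

/-! #### Smoothness -/

/-- Smooth functions. -/
def SmoothFun (E : Type*) [NormedAddCommGroup E] [NormedSpace ℝ E]
    {M : Type*} [TopologicalSpace M] [ChartedSpace E M] (f : M → ℝ) : Prop :=
  ContMDiff 𝓘(ℝ, E) 𝓘(ℝ, ℝ) ∞ f

/-- Smooth vector fields: smooth sections of the tangent bundle. -/
def SmoothVF [IsManifold 𝓘(ℝ, E) ∞ M] (X : VField E M) : Prop :=
  ContMDiff 𝓘(ℝ, E) 𝓘(ℝ, E).tangent ∞ (fun x => (⟨x, X x⟩ : TangentBundle 𝓘(ℝ, E) M))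

/-- A 1-form is smooth if its values on smooth vector fields are smooth. -/
def SmoothCov [IsManifold 𝓘(ℝ, E) ∞ M] (α : CovField E M) : Prop :=
  ∀ X : VField E M, SmoothVF X → SmoothFun E (fun x => α x (X x))

/-- A `p`-form is smooth if its values on smooth vector fields are smooth. -/
def SmoothForm [IsManifold 𝓘(ℝ, E) ∞ M] {p : ℕ} (θ : Form E M p) : Prop :=
  ∀ X : Fin p → VField E M, (∀ i, SmoothVF (X i)) → SmoothFun E (fun x => θ x (fun i => X i x))

/-- A (1,1) tensor field is smooth if it maps smooth vector fields to smooth vector fields. -/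
def SmoothEnd [IsManifold 𝓘(ℝ, E) ∞ M] (N : EndField E M) : Prop :=
  ∀ X : VField E M, SmoothVF X → SmoothVF (fun x => N x (X x))

/-- A contravariant 2-tensor is smooth if its values on smooth 1-forms are smooth. -/
def SmoothBiv [IsManifold 𝓘(ℝ, E) ∞ M] (π : BivField E M) : Prop :=
  ∀ α β : CovField E M, SmoothCov α → SmoothCov β → SmoothFun E (fun x => π x (α x) (β x))

/-! #### Exterior calculus -/

/-- The differential of a function, as a field of covectors. -/
def dFun (E : Type*) [NormedAddCommGroup E] [NormedSpace ℝ E]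
    {M : Type*} [TopologicalSpace M] [ChartedSpace E M] (f : M → ℝ) : CovField E M :=
  fun x => ((NormedSpace.fromTangentSpace (f x)).toContinuousLinearMap.comp
    (mfderiv 𝓘(ℝ, E) 𝓘(ℝ, ℝ) f x)).toLinearMap

/-- A field of covectors, as a field of alternating 1-forms. -/
def CovField.toForm (α : CovField E M) : Form E M 1 := fun x => ofCovector (α x)

/-- The pull-back of a `p`-form to the model space `E` by the inverse of the preferred chart
at `x₀`. -/
def Form.inChart [FiniteDimensional ℝ E] {p : ℕ} (x₀ : M) (θ : Form E M p) :
    E → E [⋀^Fin p]→L[ℝ] ℝ := fun y =>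
  toCont ((θ ((extChartAt 𝓘(ℝ, E) x₀).symm y)).compLinearMap
    ((mfderiv 𝓘(ℝ, E) 𝓘(ℝ, E) (extChartAt 𝓘(ℝ, E) x₀).symm y).comp
      (NormedSpace.fromTangentSpace y).symm.toContinuousLinearMap).toLinearMap)

/-- The exterior derivative of a `p`-form: its value at `x` is the exterior derivative in the
preferred chart at `x`, pulled back to `M`. -/
def extD [FiniteDimensional ℝ E] {p : ℕ} (θ : Form E M p) : Form E M (p + 1) := fun x =>
  (extDeriv (θ.inChart x) (extChartAt 𝓘(ℝ, E) x x)).toAlternatingMap.compLinearMap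
    ((NormedSpace.fromTangentSpace (extChartAt 𝓘(ℝ, E) x x)).toContinuousLinearMap.comp
      (mfderiv 𝓘(ℝ, E) 𝓘(ℝ, E) (extChartAt 𝓘(ℝ, E) x) x)).toLinearMap

/-- The wedge product of forms. -/
def Form.wedge {p q : ℕ} (η : Form E M p) (ζ : Form E M q) : Form E M (p + q) :=
  fun x => wedgeAlt (η x) (ζ x)

/-- Rewriting the degree of a form along an equality. -/
def Form.cast {p q : ℕ} (h : p = q) (η : Form E M p) : Form E M q :=
  fun x => (η x).domDomCongr (finCongr h)

/-- The operator `i_N` on forms. -/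
def iEnd {p : ℕ} (N : EndField E M) (θ : Form E M p) : Form E M p :=
  fun x => insertEndAlt (N x) (θ x)

/-- The operator `d_N = i_N ∘ d - d ∘ i_N`. -/
def dEnd [FiniteDimensional ℝ E] {p : ℕ} (N : EndField E M) (θ : Form E M p) :
    Form E M (p + 1) :=
  iEnd N (extD θ) - extD (iEnd N θ)

/-- The contraction `i_π` of forms with a bivector field. -/
def iBiv [FiniteDimensional ℝ E] {p : ℕ} (π : BivField E M) (θ : Form E M (p + 2)) :
    Form E M p :=
  fun x => insertBivectorAlt (π x) (θ x)

/-- The operator `Δ_π = i_π ∘ d - d ∘ i_π`, lowering the degree of forms by one (the second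
summand vanishes on 1-forms). -/
def koszulDelta [FiniteDimensional ℝ E] (π : BivField E M) :
    {p : ℕ} → Form E M (p + 1) → Form E M p
  | 0, θ => iBiv π (extD θ)
  | _ + 1, θ => iBiv π (extD θ) - extD (iBiv π θ)

/-- The Koszul bracket of forms of positive degrees `a` and `b`, given by Koszul's formula
`[η, ζ]_π = (-1)^a (Δ_π (η ∧ ζ) - Δ_π η ∧ ζ - (-1)^a η ∧ Δ_π ζ)`.
It is the extension, as a graded derivation of degree `a - 1` of the wedge product in each entry,
of the bracket `[α, β]_π = L_{π^♯ α} β - L_{π^♯ β} α - d⟨β, π^♯ α⟩` of 1-forms and of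
`[α, f]_π = ⟨df, π^♯ α⟩`. -/
def koszulBracket [FiniteDimensional ℝ E] (π : BivField E M) {p q : ℕ}
    (η : Form E M (p + 1)) (ζ : Form E M (q + 1)) : Form E M (p + q + 1) :=
  (-1 : ℝ) ^ (p + 1) •
    (Form.cast (p := p + 1 + q) (by omega) (koszulDelta π (p := p + 1 + q) (η.wedge ζ))
      - Form.cast (by omega) ((koszulDelta π η).wedge ζ)
      - (-1 : ℝ) ^ (p + 1) • Form.cast (by omega) (η.wedge (koszulDelta π ζ)))

/-! #### Lie derivatives -/

/-- The Lie bracket of vector fields. -/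
def bracket (X Y : VField E M) : VField E M := VectorField.mlieBracket 𝓘(ℝ, E) X Y

/-- The Lie derivative of a 1-form, `L_X α = i_X dα + d(i_X α)`. -/
def lieCov [FiniteDimensional ℝ E] (X : VField E M) (α : CovField E M) : CovField E M :=
  fun x => flat (extD α.toForm x) (X x) + dFun E (fun y => α y (X y)) x

/-- The vector field `(L_Y N) X = [Y, N X] - N [Y, X]`. -/
def lieEnd (Y : VField E M) (N : EndField E M) (X : VField E M) : VField E M :=
  fun x => bracket Y (fun y => N y (X y)) x - N x (bracket Y X x)

/-- The Nijenhuis torsion `T_N(X, Y) = [NX, NY] - N([NX, Y] + [X, NY] - N[X, Y])`. -/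
def torsion (N : EndField E M) (X Y : VField E M) : VField E M := fun x =>
  bracket (fun y => N y (X y)) (fun y => N y (Y y)) x
    - N x (bracket (fun y => N y (X y)) Y x + bracket X (fun y => N y (Y y)) x
      - N x (bracket X Y x))

/-! #### Poisson-Nijenhuis manifolds -/

/-- The bracket `{f, g} = ⟨df, π^♯ dg⟩` of two functions. -/
def poissonBracket [FiniteDimensional ℝ E] (π : BivField E M) (f g : M → ℝ) : M → ℝ :=
  fun x => dFun E f x (sharp (π x) (dFun E g x))

/-- `π` is a Poisson bivector: a smooth skew-symmetric contravariant 2-tensor field whose bracket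
of functions satisfies the Jacobi identity. -/
structure IsPoisson [FiniteDimensional ℝ E] [IsManifold 𝓘(ℝ, E) ∞ M] (π : BivField E M) :
    Prop where
  smooth : SmoothBiv π
  alt : ∀ x, (π x).IsAlt
  jacobi : ∀ f g h : M → ℝ, SmoothFun E f → SmoothFun E g → SmoothFun E h →
    poissonBracket π f (poissonBracket π g h) + poissonBracket π g (poissonBracket π h f)
      + poissonBracket π h (poissonBracket π f g) = 0

/-- Compatibility of `π` and `N`: `N π^♯ = π^♯ N^*` and
`(L_{π^♯ α} N) X - π^♯ L_X (N^* α) + π^♯ L_{NX} α = 0`. -/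
structure Compatible [FiniteDimensional ℝ E] [IsManifold 𝓘(ℝ, E) ∞ M] (π : BivField E M)
    (N : EndField E M) : Prop where
  comm : ∀ x, N x ∘ₗ sharp (π x) = sharp (π x) ∘ₗ (N x).dualMap
  concomitant : ∀ (α : CovField E M) (X : VField E M), SmoothCov α → SmoothVF X → ∀ x,
    lieEnd (fun y => sharp (π y) (α y)) N X x
      - sharp (π x) (lieCov X (fun y => (N y).dualMap (α y)) x)
      + sharp (π x) (lieCov (fun y => N y (X y)) α x) = 0

/-- `(M, π, N)` is a Poisson-Nijenhuis manifold. -/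
structure IsPN [FiniteDimensional ℝ E] [IsManifold 𝓘(ℝ, E) ∞ M] (π : BivField E M)
    (N : EndField E M) : Prop where
  poisson : IsPoisson π
  smooth : SmoothEnd N
  compatible : Compatible π N
  torsion_eq_zero : ∀ X Y : VField E M, SmoothVF X → SmoothVF Y → torsion N X Y = 0

/-! #### Deformations by a 2-form, and traces -/

/-- The (1,1) tensor field `π^♯ Ω^♭`. -/
def sharpFlat [FiniteDimensional ℝ E] (π : BivField E M) (Ω : Form E M 2) : EndField E M :=
  fun x => sharp (π x) ∘ₗ flat (Ω x)

/-- `N_+ = N + π^♯ Ω^♭`. -/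
def Nplus [FiniteDimensional ℝ E] (π : BivField E M) (N : EndField E M) (Ω : Form E M 2) :
    EndField E M :=
  N + sharpFlat π Ω

/-- `N_- = N - π^♯ Ω^♭`. -/
def Nminus [FiniteDimensional ℝ E] (π : BivField E M) (N : EndField E M) (Ω : Form E M 2) :
    EndField E M :=
  N - sharpFlat π Ω

/-- `φ_+ = d_N Ω + ½ [Ω, Ω]_π`. -/
def phiPlus [FiniteDimensional ℝ E] (π : BivField E M) (N : EndField E M) (Ω : Form E M 2) :
    Form E M 3 :=
  dEnd N Ω + (1 / 2 : ℝ) • koszulBracket π (p := 1) (q := 1) Ω Ω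

/-- `H_k = (1 / 2k) Tr(A^k)`, for a (1,1) tensor field `A`. -/
def traceH (A : EndField E M) (k : ℕ) : M → ℝ :=
  fun x => (1 / (2 * (k : ℝ))) * LinearMap.trace ℝ (TangentSpace 𝓘(ℝ, E) x) (A x ^ k)

/-- `X_k = π^♯ dH_k`, with `H_k` the traces of the powers of `A`. -/
def hamX [FiniteDimensional ℝ E] (π : BivField E M) (A : EndField E M) (k : ℕ) : VField E M :=
  fun x => sharp (π x) (dFun E (traceH A k) x)

/-- `Y_k = A^{k-1} X_1 - X_k`. -/
def vecY [FiniteDimensional ℝ E] (π : BivField E M) (A : EndField E M) (k : ℕ) : VField E M :=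
  fun x => (A x ^ (k - 1)) (hamX π A 1 x) - hamX π A k x

end Manifold

end PqN

end

/-! Write A = π^♯Ω^♭ and B = N_+ = N + A. The torsion of B splits as T_N, plus a part mixed in N and
A, plus T_A. Compatibility of π and N together with dΩ = 0 shows that the mixed part, paired with a
covector ζ, is d(i_N Ω) evaluated at (u, v, π^♯ζ) (`CompatibleJet.mixed_torsion`). By the Jacobi
identity and dΩ = 0, A is itself compatible with π (`CompatibleJet.comp_form`). The same identity
with N replaced by A therefore gives 2T_A, so ⟨ζ, T_B(u, v)⟩ is d(i_N Ω + ½ i_A Ω) at (u, v, π^♯ζ).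

Expanding the Koszul bracket gives [Ω, Ω]_π = -d(i_A Ω), hence φ_+ = -d(i_N Ω + ½ i_A Ω). Under (a')
the torsion is thus explicit (`torsion_Nplus`): T_B(u, v) = -2(dH_1(u) Av - dH_1(v) Au + Ω(u, v)
X_1).

Now take the trace of B^n T_B(u, ·). From the definition of torsion and cyclicity of the trace it
equals 2 dH_{n+1}(Bu) - 2 dH_{n+2}(u). From the explicit formula it equals -2(Tr(B^n A) dH_1(u) +
2Ω(u, B^n X_1)), and (b') replaces B^n X_1 by X_{n+1}. The term in Ω is exactly what changes B into
N_- = B - 2A, which gives (i).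

For (ii), N_- also commutes with π^♯, so evaluating dH_j(N_- X_k) in two ways gives a recursion for
the brackets {H_j, H_k}. Together with skew-symmetry it forces them all to vanish
(`eq_zero_of_lenard_recursion`).

All identities between tensor fields are checked at one point x, in the preferred chart at x, from
the values and first derivatives of π, Ω and N there. -/

noncomputable section

namespace PqN

/-! ### Pointwise algebra of the torsion of N + π^♯Ω^♭ -/

section TorsionAlgebra

/-- The derivative of `i_N O` along `u`, evaluated on `v` and `w`, when `dN` and `dO` are the
derivatives of `N` and `O`. -/
def insertDeriv {E : Type*} [NormedAddCommGroup E] [NormedSpace ℝ E]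
    (O : E →L[ℝ] E →L[ℝ] ℝ) (dO : E → E →L[ℝ] E →L[ℝ] ℝ) (N : E →L[ℝ] E) (dN : E → E → E)
    (u v w : E) : ℝ :=
  dO u (N v) w + dO u v (N w) + O (dN u v) w + O v (dN u w)

/-- The compatibility of a bivector, a (1,1) tensor and a closed 2-form at a point, in terms of
their values `P`, `N`, `O` and their derivatives `dP`, `dN`, `dO`. -/
structure CompatibleJet {E : Type*} [NormedAddCommGroup E] [NormedSpace ℝ E]
    (P : (E →L[ℝ] ℝ) →L[ℝ] E) (dP : E → (E →L[ℝ] ℝ) →L[ℝ] E)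
    (O : E →L[ℝ] E →L[ℝ] ℝ) (dO : E → E →L[ℝ] E →L[ℝ] ℝ)
    (N : E →L[ℝ] E) (dN : E → E → E) : Prop where
  skew : ∀ ξ η : E →L[ℝ] ℝ, η (P ξ) = -ξ (P η)
  form_skew : ∀ u v, O u v = -O v u
  form_dskew : ∀ w u v, dO w u v = -dO w v u
  closed : ∀ u v w, dO u v w + dO v w u + dO w u v = 0
  comm : ∀ ξ : E →L[ℝ] ℝ, N (P ξ) = P (ξ.comp N)
  concomitant : ∀ (ξ : E →L[ℝ] ℝ) (v : E) (ζ : E →L[ℝ] ℝ),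
    ζ (dN (P ξ) v) - ζ (dP (N v) ξ) + ζ (N (dP v ξ)) + ξ (dN v (P ζ)) - ξ (dN (P ζ) v) = 0

variable {E : Type*} [NormedAddCommGroup E] [NormedSpace ℝ E]
  {P : (E →L[ℝ] ℝ) →L[ℝ] E} {dP : E → (E →L[ℝ] ℝ) →L[ℝ] E}
  {O : E →L[ℝ] E →L[ℝ] ℝ} {dO : E → E →L[ℝ] E →L[ℝ] ℝ}
  {N : E →L[ℝ] E} {dN : E → E → E}

/-- The mixed torsion of `N` and `P O`, paired with a covector, is the contraction of
`d (i_N O)`. -/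
theorem CompatibleJet.mixed_torsion (h : CompatibleJet P dP O dO N dN) (u v : E)
    (ζ : E →L[ℝ] ℝ) :
    ζ (dP (N u) (O v) + P (dO (N u) v) - dN (P (O v)) u + dN (P (O u)) v
        - dP (N v) (O u) - P (dO (N v) u)
        - N (dP u (O v) + P (dO u v) - dP v (O u) - P (dO v u)) - P (O (dN u v - dN v u)))
      = insertDeriv O dO N dN u v (P ζ) - insertDeriv O dO N dN v u (P ζ)
        + insertDeriv O dO N dN (P ζ) u v := by
  -- The concomitant at the covectors O v and O u trades all derivatives of P for derivatives of N;
  -- closedness on (Nu, v, Pζ) and (Nv, u, Pζ) rearranges the derivatives of O.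
  have c1 := h.concomitant (O v) u ζ
  have c2 := h.concomitant (O u) v ζ
  have e : ∀ ξ, ζ (N (P ξ)) = -ξ (N (P ζ)) := fun ξ => by
    rw [h.comm, h.skew]; rfl
  have s : ∀ ξ, ζ (P ξ) = -ξ (P ζ) := fun ξ => h.skew ξ ζ
  have k1 := h.closed (N u) v (P ζ)
  have k2 := h.closed (N v) u (P ζ)
  have d1 := h.form_dskew v (P ζ) (N u)
  have d2 := h.form_dskew u (P ζ) (N v)
  have d3 := h.form_dskew (P ζ) u (N v)
  have d4 := h.form_skew (dN (P ζ) u) v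
  simp only [map_add, map_sub, e, s, insertDeriv]
  linear_combination c2 - c1 - k1 + k2 + d1 - d2 - d4 - d3

/-- The tensor `P O` is compatible with the Poisson bivector `P`, if `O` is closed. -/
theorem CompatibleJet.comp_form (h : CompatibleJet P dP O dO N dN)
    (dskew : ∀ (u : E) (ξ η : E →L[ℝ] ℝ), η (dP u ξ) = -ξ (dP u η))
    (jacobi : ∀ ξ η ζ : E →L[ℝ] ℝ, ζ (dP (P ξ) η) + ξ (dP (P η) ζ) + η (dP (P ζ) ξ) = 0) :
    CompatibleJet P dP O dO (P.comp O) (fun u v => dP u (O v) + P (dO u v)) where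
  skew := h.skew
  form_skew := h.form_skew
  form_dskew := h.form_dskew
  closed := h.closed
  comm ξ := by
    have : O (P ξ) = ξ.comp (P.comp O) := by
      ext v
      simp only [ContinuousLinearMap.comp_apply]
      rw [h.form_skew, h.skew ξ, neg_neg]
    simp [this]
  concomitant ξ v ζ := by
    -- Jacobi on (ξ, O v, ζ) cancels the derivatives of P, closedness on (Pξ, v, Pζ) those of O; the
    -- rest is skew-symmetry.
    have j := jacobi ξ (O v) ζ
    have k := h.closed (P ξ) v (P ζ)
    have s : ∀ ξ, ζ (P ξ) = -ξ (P ζ) := fun ξ => h.skew ξ ζ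
    have s' : ∀ ζ, ξ (P ζ) = -ζ (P ξ) := fun ζ => h.skew ζ ξ
    have d1 := dskew (P (O v)) ξ ζ
    have d2 := dskew (P ζ) ξ (O v)
    have d3 := h.form_skew (dP v ξ) (P ζ)
    have d4 := dskew v (O (P ζ)) ξ
    have d6 := h.form_dskew (P ζ) v (P ξ)
    simp only [map_add, s, s', ContinuousLinearMap.comp_apply]
    linear_combination j - k - d2 - d1 - d3 + d4 + d6

/-- The torsion of `N + P O`, paired with a covector, is the contraction of
`d (i_N O + ½ i_{P O} O)`. -/
theorem CompatibleJet.torsion_add (h : CompatibleJet P dP O dO N dN)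
    (dskew : ∀ (u : E) (ξ η : E →L[ℝ] ℝ), η (dP u ξ) = -ξ (dP u η))
    (jacobi : ∀ ξ η ζ : E →L[ℝ] ℝ, ζ (dP (P ξ) η) + ξ (dP (P η) ζ) + η (dP (P ζ) ξ) = 0)
    (dP_add : ∀ u v, dP (u + v) = dP u + dP v) (dO_add : ∀ u v, dO (u + v) = dO u + dO v)
    (dN_add : ∀ u v w, dN (u + v) w = dN u w + dN v w)
    (torsion : ∀ u v, dN (N u) v - dN (N v) u - N (dN u v) + N (dN v u) = 0)
    (A : E →L[ℝ] E) (hA : A = P.comp O) (dA : E → E → E)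
    (hdA : dA = fun u v => dP u (O v) + P (dO u v)) (u v : E) (ζ : E →L[ℝ] ℝ) :
    ζ ((dN (N u + A u) v + dA (N u + A u) v) - (dN (N v + A v) u + dA (N v + A v) u)
        - (N (dN u v + dA u v) + A (dN u v + dA u v))
        + (N (dN v u + dA v u) + A (dN v u + dA v u)))
      = insertDeriv O dO N dN u v (P ζ) - insertDeriv O dO N dN v u (P ζ)
        + insertDeriv O dO N dN (P ζ) u v
        + (1 / 2) * (insertDeriv O dO A dA u v (P ζ) - insertDeriv O dO A dA v u (P ζ)
        + insertDeriv O dO A dA (P ζ) u v) := by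
  have hN := h.mixed_torsion u v ζ
  -- With N replaced by A = P O, the mixed torsion is twice the torsion of A, whence the factor ½.
  have hAA := (h.comp_form dskew jacobi).mixed_torsion u v ζ
  have t := congrArg ζ (torsion u v)
  rw [← hdA, ← hA] at hAA
  rw [← hN, ← hAA]
  subst hA hdA
  simp only [map_add, map_sub, map_zero, dP_add, dO_add, dN_add, ContinuousLinearMap.comp_apply,
    _root_.add_apply] at t ⊢
  linear_combination t

end TorsionAlgebra

/-! ### Trace of the torsion, and the recursion for the brackets -/

section Traces

variable {V : Type*} [AddCommGroup V] [Module ℝ V]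

/-- The trace of `B^n ∘ T(u, ·)`, where `T(u, v) = D(Bu)v - D(Bv)u - B(D(u)v) + B(D(v)u)`. -/
theorem trace_pow_mul_torsion [FiniteDimensional ℝ V] (B : Module.End ℝ V)
    (D : V →ₗ[ℝ] V →ₗ[ℝ] V) (u : V) (T : Module.End ℝ V)
    (hT : ∀ v, T v = D (B u) v - D (B v) u - B (D u v) + B (D v u)) (n : ℕ) :
    LinearMap.trace ℝ V (B ^ n * T)
      = LinearMap.trace ℝ V (B ^ n * D (B u)) - LinearMap.trace ℝ V (B ^ (n + 1) * D u) := by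
  have e : T = D (B u) - D.flip u * B - B * D u + B * D.flip u := by
    ext v; simp [hT]
  -- The two terms of the torsion in which the free argument v is the direction of differentiation
  -- cancel under the trace, by cyclicity.
  have c : LinearMap.trace ℝ V (B ^ n * (D.flip u * B))
      = LinearMap.trace ℝ V (B ^ n * (B * D.flip u)) := by
    rw [← mul_assoc, LinearMap.trace_mul_comm, ← mul_assoc, ← mul_assoc, ← pow_succ, pow_succ']
  rw [e]
  simp only [mul_add, mul_sub, map_add, map_sub, c, pow_succ, mul_assoc]
  ring

/-- A skew-symmetric family satisfying the recursion of a generalized Lenard-Magri chain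
vanishes. -/
theorem eq_zero_of_lenard_recursion (a : ℕ → ℕ → ℝ) (f : ℕ → ℝ)
    (skew : ∀ j k, a j k = -a k j)
    (rec : ∀ j k, 1 ≤ j → 1 ≤ k → a (j + 1) k + f j * a 1 k = a j (k + 1) + f k * a j 1)
    (j k : ℕ) (hj : 1 ≤ j) (hk : 1 ≤ k) : a j k = 0 := by
  have key : ∀ n, ∀ j k, 1 ≤ j → 1 ≤ k → j + k = n → a j k = 0 := by
    intro n
    induction n using Nat.strong_induction_on with
    | _ n ih =>
    have shift : ∀ i j, 1 ≤ j → i + 1 + j = n → a (i + 1) j = a 1 (i + j) := by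
      intro i
      induction i with
      | zero => intro j _ _; simp
      | succ i hi =>
        intro j hj hn
        -- Both `f` terms multiply entries of index sum less than `n`, zero by induction; what
        -- remains moves one unit from the first index to the second.
        have r := rec (i + 1) j (by omega) hj
        rw [ih (1 + j) (by omega) 1 j le_rfl hj rfl,
          ih (i + 1 + 1) (by omega) (i + 1) 1 (by omega) le_rfl rfl] at r
        have := hi (j + 1) (by omega) (by omega)
        rw [show i + 1 + j = i + (j + 1) by ring, ← this]
        linarith
    intro j k hj hk hn
    obtain ⟨j, rfl⟩ := Nat.exists_eq_add_of_le' hj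
    obtain ⟨k, rfl⟩ := Nat.exists_eq_add_of_le' hk
    -- All entries on the antidiagonal of index sum `n` are equal, in particular an entry and its
    -- transpose, which are opposite.
    have h1 := shift j (k + 1) (by omega) hn
    have h2 := shift k (j + 1) (by omega) (by omega)
    have h3 := skew (j + 1) (k + 1)
    rw [show k + (j + 1) = j + (k + 1) by ring] at h2
    linarith
  exact key _ j k hj hk rfl

end Traces

/-! ### Signed sums over permutations of three and four indices -/

section SignedSums

-- A permutation is a transposition (0 p) times a permutation fixing 0, with sign -1 for the
-- transposition unless p = 0. Iterating this enumerates the signed sums that define low-degree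
-- wedge products.
open Equiv.Perm in
theorem sum_sign_perm_fin_succ {n : ℕ} (F : Equiv.Perm (Fin (n + 1)) → ℝ) :
    ∑ σ : Equiv.Perm (Fin (n + 1)), ((sign σ : ℤ) : ℝ) * F σ
      = ∑ p : Fin (n + 1), ∑ e : Equiv.Perm (Fin n), (if p = 0 then 1 else -1) *
        (((sign e : ℤ) : ℝ) * F (decomposeFin.symm (p, e))) := by
  rw [Finset.univ_perm_fin_succ, ← Finset.univ_product_univ, Finset.sum_map, Finset.sum_product]
  refine Finset.sum_congr rfl fun p _ => Finset.sum_congr rfl fun e _ => ?_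
  simp only [Equiv.toEmbedding_apply, decomposeFin.symm_sign]
  split_ifs <;> simp

open Equiv.Perm in
theorem sum_sign_perm_fin_three (F : Fin 3 → Fin 3 → Fin 3 → ℝ) :
    ∑ σ : Equiv.Perm (Fin 3), ((sign σ : ℤ) : ℝ) * F (σ 0) (σ 1) (σ 2)
      = F 0 1 2 - F 0 2 1 - F 1 0 2 + F 1 2 0 + F 2 0 1 - F 2 1 0 := by
  have h1 : ∀ (p : Fin 3) (e : Equiv.Perm (Fin 2)),
      decomposeFin.symm (p, e) 1 = Equiv.swap 0 p (e 0).succ :=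
    fun p e => decomposeFin_symm_apply_succ e p 0
  have h2 : ∀ (p : Fin 3) (e : Equiv.Perm (Fin 2)),
      decomposeFin.symm (p, e) 2 = Equiv.swap 0 p (e 1).succ :=
    fun p e => decomposeFin_symm_apply_succ e p 1
  have h3 : ∀ (p : Fin 2) (e : Equiv.Perm (Fin 1)),
      decomposeFin.symm (p, e) 1 = Equiv.swap 0 p (e 0).succ :=
    fun p e => decomposeFin_symm_apply_succ e p 0
  have s : (Equiv.swap 0 1 2 : Fin 3) = 2 := by decide
  have s' : (Equiv.swap 0 2 1 : Fin 3) = 1 := by decide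
  simp [sum_sign_perm_fin_succ, Fin.sum_univ_succ, h1, h2, h3, s, s', Fin.succ_one_eq_two,
    Equiv.swap_apply_right]
  ring

open Equiv.Perm in
theorem sum_sign_perm_fin_four (F : Fin 4 → Fin 4 → Fin 4 → Fin 4 → ℝ) :
    ∑ σ : Equiv.Perm (Fin 4), ((sign σ : ℤ) : ℝ) * F (σ 0) (σ 1) (σ 2) (σ 3)
      = ∑ p : Fin 4, (if p = 0 then 1 else -1) *
        (F p (Equiv.swap 0 p 1) (Equiv.swap 0 p 2) (Equiv.swap 0 p 3)
          - F p (Equiv.swap 0 p 1) (Equiv.swap 0 p 3) (Equiv.swap 0 p 2)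
          - F p (Equiv.swap 0 p 2) (Equiv.swap 0 p 1) (Equiv.swap 0 p 3)
          + F p (Equiv.swap 0 p 2) (Equiv.swap 0 p 3) (Equiv.swap 0 p 1)
          + F p (Equiv.swap 0 p 3) (Equiv.swap 0 p 1) (Equiv.swap 0 p 2)
          - F p (Equiv.swap 0 p 3) (Equiv.swap 0 p 2) (Equiv.swap 0 p 1)) := by
  rw [sum_sign_perm_fin_succ]
  refine Finset.sum_congr rfl fun p _ => ?_
  rw [← Finset.mul_sum]
  refine congrArg _ (Eq.trans ?_
    (sum_sign_perm_fin_three fun i j k => F p (Equiv.swap 0 p (Fin.succ i))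
      (Equiv.swap 0 p (Fin.succ j)) (Equiv.swap 0 p (Fin.succ k))))
  refine Finset.sum_congr rfl fun e _ => ?_
  have h1 : decomposeFin.symm (p, e) 1 = Equiv.swap 0 p (e 0).succ :=
    decomposeFin_symm_apply_succ e p 0
  have h2 : decomposeFin.symm (p, e) 2 = Equiv.swap 0 p (e 1).succ :=
    decomposeFin_symm_apply_succ e p 1
  have h3 : decomposeFin.symm (p, e) 3 = Equiv.swap 0 p (e 2).succ :=
    decomposeFin_symm_apply_succ e p 2
  rw [decomposeFin_symm_apply_zero, h1, h2, h3]

end SignedSums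

/-! ### Wedge products and contractions in low degree -/

section Wedge

variable {V : Type*} [AddCommGroup V] [Module ℝ V]

theorem alt_two_swap (b : V [⋀^Fin 2]→ₗ[ℝ] ℝ) (x y : V) : b ![y, x] = -b ![x, y] := by
  have := b.map_swap ![x, y] (i := 0) (j := 1) (by decide)
  rw [← this]
  congr 1
  ext i
  fin_cases i <;> rfl

theorem alternatingMap_sum_apply {ι : Type*} {p : ℕ} (s : Finset ι) (a : ι → V [⋀^Fin p]→ₗ[ℝ] ℝ)
    (v : Fin p → V) : (∑ i ∈ s, a i) v = ∑ i ∈ s, a i v := by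
  induction s using Finset.cons_induction with
  | empty => simp
  | cons i s hi ih => rw [Finset.sum_cons, Finset.sum_cons, AlternatingMap.add_apply, ih]

/-- Each shuffle is counted once for every permutation within its two blocks. Full permutations are
easier to enumerate than the quotient used by `domCoprod`. -/
theorem factorial_smul_wedgeAlt {p q : ℕ} (a : V [⋀^Fin p]→ₗ[ℝ] ℝ) (b : V [⋀^Fin q]→ₗ[ℝ] ℝ)
    (v : Fin (p + q) → V) :
    ((p.factorial * q.factorial : ℕ) : ℝ) * wedgeAlt a b v
      = ∑ σ : Equiv.Perm (Fin (p + q)), ((Equiv.Perm.sign σ : ℤ) : ℝ) *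
        (a (fun i => v (σ (Fin.castAdd q i))) * b (fun i => v (σ (Fin.natAdd p i)))) := by
  have h := congrArg (fun m => LinearMap.mul' ℝ ℝ (m (fun i => v (finSumFinEquiv i))))
    (MultilinearMap.domCoprod_alternization_eq a b)
  simp only [Fintype.card_fin, AlternatingMap.smul_apply, map_nsmul] at h
  have e : wedgeAlt a b v = LinearMap.mul' ℝ ℝ (a.domCoprod b (fun i => v (finSumFinEquiv i))) :=
    rfl
  rw [e, ← nsmul_eq_mul, ← h, MultilinearMap.alternatization_apply, map_sum]
  refine Fintype.sum_equiv (Equiv.permCongr finSumFinEquiv) _ _ fun σ => ?_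
  rw [Equiv.Perm.sign_permCongr, Units.smul_def, map_zsmul, zsmul_eq_mul]
  simp [MultilinearMap.domCoprod_apply]

theorem wedgeAlt_one_two (a : V [⋀^Fin 1]→ₗ[ℝ] ℝ) (b : V [⋀^Fin 2]→ₗ[ℝ] ℝ) (v : Fin 3 → V) :
    wedgeAlt a b v = a ![v 0] * b ![v 1, v 2] - a ![v 1] * b ![v 0, v 2]
      + a ![v 2] * b ![v 0, v 1] := by
  have h := (factorial_smul_wedgeAlt a b v).trans
    (Finset.sum_congr rfl fun σ _ => by
      rw [show (fun i => v (σ (Fin.castAdd 2 i))) = ![v (σ 0)] by ext i; fin_cases i; rfl,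
        show (fun i => v (σ (Fin.natAdd 1 i))) = ![v (σ 1), v (σ 2)] by
          ext i; fin_cases i <;> rfl])
  rw [sum_sign_perm_fin_three fun i j k => a ![v i] * b ![v j, v k]] at h
  have s1 := alt_two_swap b (v 0) (v 1)
  have s2 := alt_two_swap b (v 0) (v 2)
  have s3 := alt_two_swap b (v 1) (v 2)
  simp only [Nat.factorial] at h
  push_cast at h
  rw [s1, s2, s3] at h
  linarith

theorem wedgeAlt_two_one (a : V [⋀^Fin 2]→ₗ[ℝ] ℝ) (b : V [⋀^Fin 1]→ₗ[ℝ] ℝ) (v : Fin 3 → V) :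
    wedgeAlt a b v = a ![v 0, v 1] * b ![v 2] - a ![v 0, v 2] * b ![v 1]
      + a ![v 1, v 2] * b ![v 0] := by
  have h := (factorial_smul_wedgeAlt a b v).trans
    (Finset.sum_congr rfl fun σ _ => by
      rw [show (fun i => v (σ (Fin.castAdd 1 i))) = ![v (σ 0), v (σ 1)] by
          ext i; fin_cases i <;> rfl,
        show (fun i => v (σ (Fin.natAdd 2 i))) = ![v (σ 2)] by ext i; fin_cases i; rfl])
  rw [sum_sign_perm_fin_three fun i j k => a ![v i, v j] * b ![v k]] at h
  have s1 := alt_two_swap a (v 0) (v 1)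
  have s2 := alt_two_swap a (v 0) (v 2)
  have s3 := alt_two_swap a (v 1) (v 2)
  simp only [Nat.factorial] at h
  push_cast at h
  rw [s1, s2, s3] at h
  linarith

theorem wedgeAlt_two_two_self (a : V [⋀^Fin 2]→ₗ[ℝ] ℝ) (v : Fin 4 → V) :
    wedgeAlt a a v = 2 * (a ![v 0, v 1] * a ![v 2, v 3] - a ![v 0, v 2] * a ![v 1, v 3]
      + a ![v 0, v 3] * a ![v 1, v 2]) := by
  have h := (factorial_smul_wedgeAlt a a v).trans
    (Finset.sum_congr rfl fun σ _ => by
      rw [show (fun i => v (σ (Fin.castAdd 2 i))) = ![v (σ 0), v (σ 1)] by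
          ext i; fin_cases i <;> rfl,
        show (fun i => v (σ (Fin.natAdd 2 i))) = ![v (σ 2), v (σ 3)] by
          ext i; fin_cases i <;> rfl])
  rw [sum_sign_perm_fin_four fun i j k l => a ![v i, v j] * a ![v k, v l]] at h
  have p12 : (Equiv.swap 0 1 2 : Fin 4) = 2 := by decide
  have p13 : (Equiv.swap 0 1 3 : Fin 4) = 3 := by decide
  have p21 : (Equiv.swap 0 2 1 : Fin 4) = 1 := by decide
  have p23 : (Equiv.swap 0 2 3 : Fin 4) = 3 := by decide
  have p31 : (Equiv.swap 0 3 1 : Fin 4) = 1 := by decide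
  have p32 : (Equiv.swap 0 3 2 : Fin 4) = 2 := by decide
  rw [Fin.sum_univ_four] at h
  simp only [p12, p13, p21, p23, p31, p32, Equiv.swap_apply_right, Equiv.swap_self,
    Equiv.refl_apply, Nat.factorial, alt_two_swap a (v 0) (v 1), alt_two_swap a (v 0) (v 2),
    alt_two_swap a (v 0) (v 3), alt_two_swap a (v 1) (v 2), alt_two_swap a (v 1) (v 3),
    alt_two_swap a (v 2) (v 3)] at h
  rw [if_pos trivial, if_neg (by decide), if_neg (by decide), if_neg (by decide)] at h
  norm_num at h
  linarith

theorem insertEndAlt_two (A : Module.End ℝ V) (a : V [⋀^Fin 2]→ₗ[ℝ] ℝ) (v w : V) :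
    insertEndAlt A a ![v, w] = a ![A v, w] + a ![v, A w] := by
  change ∑ i : Fin 2, a (Function.update ![v, w] i (A (![v, w] i))) = _
  rw [Fin.sum_univ_two]
  congr 2 <;> ext i <;> fin_cases i <;> simp

theorem insertEndAlt_zero {p : ℕ} (A : Module.End ℝ V) :
    insertEndAlt A (0 : V [⋀^Fin p]→ₗ[ℝ] ℝ) = 0 := by
  ext v
  change ∑ i : Fin p, (0 : ℝ) = 0
  simp

theorem flat_apply (a : V [⋀^Fin 2]→ₗ[ℝ] ℝ) (v w : V) : flat a v w = a ![v, w] := rfl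

variable [FiniteDimensional ℝ V]

theorem insertBivectorAlt_zero {p : ℕ} (P : LinearMap.BilinForm ℝ (Module.Dual ℝ V)) :
    insertBivectorAlt P (0 : V [⋀^Fin (p + 2)]→ₗ[ℝ] ℝ) = 0 := by
  ext v
  simp [insertBivectorAlt]

theorem sharp_skew {P : LinearMap.BilinForm ℝ (Module.Dual ℝ V)} (hP : P.IsAlt)
    (α β : Module.Dual ℝ V) : β (sharp P α) = -α (sharp P β) := by
  rw [apply_sharp, apply_sharp, hP.neg_eq]

theorem sum_alt_sharp {P : LinearMap.BilinForm ℝ (Module.Dual ℝ V)} (hP : P.IsAlt)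
    (a : V [⋀^Fin 2]→ₗ[ℝ] ℝ) :
    ∑ i, a ![Module.finBasis ℝ V i, sharp P ((Module.finBasis ℝ V).coord i)]
      = -LinearMap.trace ℝ V (sharp P ∘ₗ flat a) := by
  rw [LinearMap.trace_eq_matrix_trace ℝ (Module.finBasis ℝ V), Matrix.trace,
    ← Finset.sum_neg_distrib]
  refine Finset.sum_congr rfl fun i _ => ?_
  rw [Matrix.diag_apply, LinearMap.toMatrix_apply, ← flat_apply, sharp_skew hP]
  rfl

/-- The numbers a(v, e_i) are the coordinates of the covector a(v, ·) in the dual basis, so the sum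
reassembles P^♯ a^♭ v; the sign comes from swapping e_i and v. These are the cross terms in the
contraction of a ∧ a. -/
theorem sum_alt_mul_alt_sharp (P : LinearMap.BilinForm ℝ (Module.Dual ℝ V))
    (a : V [⋀^Fin 2]→ₗ[ℝ] ℝ) (v w : V) :
    ∑ i, a ![Module.finBasis ℝ V i, v] * a ![sharp P ((Module.finBasis ℝ V).coord i), w]
      = -a ![sharp P (flat a v), w] := by
  have e : ∀ i, a ![Module.finBasis ℝ V i, v] * a ![sharp P ((Module.finBasis ℝ V).coord i), w]
      = -(flat a v (Module.finBasis ℝ V i) *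
        flat a (sharp P ((Module.finBasis ℝ V).coord i)) w) := fun i => by
    rw [alt_two_swap, flat_apply, flat_apply]; ring
  have h : flat a v = ∑ i, flat a v (Module.finBasis ℝ V i) • (Module.finBasis ℝ V).coord i :=
    ((Module.finBasis ℝ V).sum_dual_apply_smul_coord _).symm
  rw [Finset.sum_congr rfl fun i _ => e i, Finset.sum_neg_distrib, ← flat_apply]
  conv_rhs => rw [h]
  simp only [map_sum, map_smul, LinearMap.sum_apply, LinearMap.smul_apply, smul_eq_mul]

/-- `i_P a = -½ Tr(P^♯ a^♭)` for a 2-form `a`. -/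
theorem insertBivectorAlt_two {P : LinearMap.BilinForm ℝ (Module.Dual ℝ V)} (hP : P.IsAlt)
    (a : V [⋀^Fin 2]→ₗ[ℝ] ℝ) (v : Fin 0 → V) :
    insertBivectorAlt (p := 0) P a v = -(1 / 2) * LinearMap.trace ℝ V (sharp P ∘ₗ flat a) := by
  have h := sum_alt_sharp hP a
  have e : insertBivectorAlt (p := 0) P a v = (1 / 2 : ℝ) *
      ∑ i, a ![Module.finBasis ℝ V i, sharp P ((Module.finBasis ℝ V).coord i)] := by
    rw [insertBivectorAlt, AlternatingMap.smul_apply, alternatingMap_sum_apply, smul_eq_mul]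
    congr 1
    refine Finset.sum_congr rfl fun i _ => ?_
    change a _ = a _
    congr 1
    ext j
    fin_cases j <;> rfl
  rw [e, h]
  ring

/-- `i_P (a ∧ a) = -Tr(P^♯ a^♭) a + i_{P^♯ a^♭} a` for a 2-form `a`. -/
theorem insertBivectorAlt_wedge_self {P : LinearMap.BilinForm ℝ (Module.Dual ℝ V)}
    (hP : P.IsAlt) (a : V [⋀^Fin 2]→ₗ[ℝ] ℝ) :
    insertBivectorAlt (p := 2) P (wedgeAlt a a)
      = -LinearMap.trace ℝ V (sharp P ∘ₗ flat a) • a + insertEndAlt (sharp P ∘ₗ flat a) a := by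
  ext v
  obtain ⟨x, y, rfl⟩ : ∃ x y, v = ![x, y] :=
    ⟨v 0, v 1, by ext i; fin_cases i <;> rfl⟩
  have e : insertBivectorAlt (p := 2) P (wedgeAlt a a) ![x, y] = (1 / 2 : ℝ) *
      ∑ i, wedgeAlt a a
        ![Module.finBasis ℝ V i, sharp P ((Module.finBasis ℝ V).coord i), x, y] := by
    rw [insertBivectorAlt, AlternatingMap.smul_apply, alternatingMap_sum_apply, smul_eq_mul]
    rfl
  have s : ∀ i, wedgeAlt a a
      ![Module.finBasis ℝ V i, sharp P ((Module.finBasis ℝ V).coord i), x, y]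
      = 2 * (a ![Module.finBasis ℝ V i, sharp P ((Module.finBasis ℝ V).coord i)] * a ![x, y]
        - a ![Module.finBasis ℝ V i, x] * a ![sharp P ((Module.finBasis ℝ V).coord i), y]
        + a ![Module.finBasis ℝ V i, y] * a ![sharp P ((Module.finBasis ℝ V).coord i), x]) :=
    fun i => wedgeAlt_two_two_self a _
  rw [e, Finset.sum_congr rfl fun i _ => s i, ← Finset.mul_sum, Finset.sum_add_distrib,
    Finset.sum_sub_distrib, ← Finset.sum_mul, sum_alt_sharp hP, sum_alt_mul_alt_sharp,
    sum_alt_mul_alt_sharp, AlternatingMap.add_apply, insertEndAlt_two, AlternatingMap.smul_apply,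
    smul_eq_mul, alt_two_swap a x, LinearMap.comp_apply, LinearMap.comp_apply]
  ring

end Wedge

/-! ### Brackets, differentials and exterior derivatives in the preferred chart -/

section ChartCalculus

open Filter Topology

theorem eventually_mem_chart_source {H M : Type*} [TopologicalSpace H] [TopologicalSpace M]
    [ChartedSpace H M] (x : M) : ∀ᶠ z in 𝓝 x, z ∈ (chartAt H x).source :=
  (chartAt H x).open_source.mem_nhds (mem_chart_source H x)

variable {E : Type*} [NormedAddCommGroup E] [NormedSpace ℝ E]
  {M : Type*} [TopologicalSpace M] [ChartedSpace E M]

/-- The derivative at the centre of the preferred chart at `x` of a function read in this chart. -/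
def HasChartDeriv {F : Type*} [NormedAddCommGroup F] [NormedSpace ℝ F] (f : M → F)
    (f' : E →L[ℝ] F) (x : M) : Prop :=
  HasFDerivAt (fun y => f ((extChartAt 𝓘(ℝ, E) x).symm y)) f' (extChartAt 𝓘(ℝ, E) x x)

theorem tendsto_extChartAt_symm (x : M) :
    Tendsto (extChartAt 𝓘(ℝ, E) x).symm (𝓝 (extChartAt 𝓘(ℝ, E) x x)) (𝓝 x) := by
  have := continuousAt_extChartAt_symm (I := 𝓘(ℝ, E)) x
  rwa [ContinuousAt, extChartAt_to_inv] at this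

theorem HasChartDeriv.congr {F : Type*} [NormedAddCommGroup F] [NormedSpace ℝ F] {f g : M → F}
    {f' : E →L[ℝ] F} {x : M} (h : HasChartDeriv f f' x) (hg : g =ᶠ[𝓝 x] f) :
    HasChartDeriv g f' x :=
  HasFDerivAt.congr_of_eventuallyEq h ((tendsto_extChartAt_symm x).eventually hg)

theorem HasChartDeriv.unique {F : Type*} [NormedAddCommGroup F] [NormedSpace ℝ F] {f : M → F}
    {f' f'' : E →L[ℝ] F} {x : M} (h : HasChartDeriv f f' x) (h' : HasChartDeriv f f'' x) :
    f' = f'' :=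
  HasFDerivAt.unique h h'

theorem hasChartDeriv_of_contMDiffAt [IsManifold 𝓘(ℝ, E) ∞ M] {F : Type*} [NormedAddCommGroup F]
    [NormedSpace ℝ F] {f : M → F} {x : M} (hf : ContMDiffAt 𝓘(ℝ, E) 𝓘(ℝ, F) ∞ f x) :
    ∃ f' : E →L[ℝ] F, HasChartDeriv f f' x := by
  have h := hf.mdifferentiableAt (by simp)
  have h' := h.differentiableWithinAt_writtenInExtChartAt
  simp only [ModelWithCorners.range_eq_univ, differentiableWithinAt_univ] at h'
  exact ⟨_, h'.hasFDerivAt⟩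

/-- The derivative at `x` of a function with a derivative in the chart at `x`. -/
theorem HasChartDeriv.hasMFDerivAt [IsManifold 𝓘(ℝ, E) ∞ M] {F : Type*} [NormedAddCommGroup F]
    [NormedSpace ℝ F] {f : M → F} {f' : E →L[ℝ] F} {x : M} (h : HasChartDeriv f f' x) :
    HasMFDerivAt 𝓘(ℝ, E) 𝓘(ℝ, F) f x f' := by
  refine ⟨?_, ?_⟩
  · have h1 : ContinuousAt (fun z => f ((extChartAt 𝓘(ℝ, E) x).symm (extChartAt 𝓘(ℝ, E) x z))) x :=
      ContinuousAt.comp (f := extChartAt 𝓘(ℝ, E) x)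
        (g := fun y => f ((extChartAt 𝓘(ℝ, E) x).symm y)) h.continuousAt (continuousAt_extChartAt x)
    refine h1.congr ?_
    filter_upwards [extChartAt_source_mem_nhds (I := 𝓘(ℝ, E)) x] with z hz
    rw [(extChartAt 𝓘(ℝ, E) x).left_inv hz]
  · simp only [ModelWithCorners.range_eq_univ]
    exact HasFDerivAt.hasFDerivWithinAt h

variable [IsManifold 𝓘(ℝ, E) ∞ M]

/-- The tangent map at `z` of the preferred chart at `x`. -/
def chartD (x z : M) : TangentSpace 𝓘(ℝ, E) z →L[ℝ] E :=
  (trivializationAt E (TangentSpace 𝓘(ℝ, E)) x).continuousLinearMapAt ℝ z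

/-- The inverse of the tangent map at `z` of the preferred chart at `x`. -/
def chartC (x z : M) : E →L[ℝ] TangentSpace 𝓘(ℝ, E) z :=
  (trivializationAt E (TangentSpace 𝓘(ℝ, E)) x).symmL ℝ z

theorem chartD_chartC {x z : M} (hz : z ∈ (chartAt E x).source) (v : E) :
    chartD x z (chartC x z v) = v :=
  Bundle.Trivialization.continuousLinearMapAt_symmL _ (by simpa using hz) v

theorem chartC_chartD {x z : M} (hz : z ∈ (chartAt E x).source) (v : TangentSpace 𝓘(ℝ, E) z) :
    chartC x z (chartD x z v) = v :=
  Bundle.Trivialization.symmL_continuousLinearMapAt _ (by simpa using hz) v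

theorem chartD_self (x : M) (v : TangentSpace 𝓘(ℝ, E) x) : chartD x x v = v := by
  have h := TangentBundle.continuousLinearMapAt_trivializationAt (𝕜 := ℝ) (I := 𝓘(ℝ, E))
    (mem_chart_source E x)
  rw [mfderiv_extChartAt_self] at h
  exact congrArg (fun l => l v) h

theorem chartC_self (x : M) (v : E) : chartC (E := E) x x v = v := by
  have h := chartD_chartC (mem_chart_source E x) v
  rwa [chartD_self] at h

theorem mfderivWithin_symm_eq_chartC {x : M} {y : E} (hy : y ∈ (extChartAt 𝓘(ℝ, E) x).target)
    (v : E) :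
    mfderiv 𝓘(ℝ, E) 𝓘(ℝ, E) (extChartAt 𝓘(ℝ, E) x).symm y v
      = chartC x ((extChartAt 𝓘(ℝ, E) x).symm y) v := by
  have hs : (extChartAt 𝓘(ℝ, E) x).symm y ∈ (chartAt E x).source := by
    simpa using (extChartAt 𝓘(ℝ, E) x).map_target hy
  have h := TangentBundle.symmL_trivializationAt (𝕜 := ℝ) (I := 𝓘(ℝ, E)) hs
  rw [(extChartAt 𝓘(ℝ, E) x).right_inv hy, ModelWithCorners.range_eq_univ,
    mfderivWithin_univ] at h
  exact (congrArg (fun l => l v) h).symm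

/-- The bracket on M is the bracket in E of the pull-backs by the inverse chart. Near the centre
these pull-backs are the readings through `chartD`, and at the centre the tangent map of the chart
is the identity. -/
theorem chartD_bracket {x : M} {X Y : VField E M} {X' Y' : E →L[ℝ] E}
    (hX : HasChartDeriv (fun z => chartD x z (X z)) X' x)
    (hY : HasChartDeriv (fun z => chartD x z (Y z)) Y' x) :
    chartD x x (bracket X Y x) = Y' (chartD x x (X x)) - X' (chartD x x (Y x)) := by
  let pull : VField E M → E → E := fun Z =>
    VectorField.mpullbackWithin 𝓘(ℝ, E) 𝓘(ℝ, E) (extChartAt 𝓘(ℝ, E) x).symm Z Set.univ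
  let rep : VField E M → E → E := fun Z y =>
    chartD x ((extChartAt 𝓘(ℝ, E) x).symm y) (Z ((extChartAt 𝓘(ℝ, E) x).symm y))
  have key : ∀ Z : VField E M, pull Z =ᶠ[𝓝 (extChartAt 𝓘(ℝ, E) x x)] rep Z := by
    intro Z
    filter_upwards [extChartAt_target_mem_nhds (I := 𝓘(ℝ, E)) x] with y hy
    have hs : (extChartAt 𝓘(ℝ, E) x).symm y ∈ (chartAt E x).source := by
      simpa using (extChartAt 𝓘(ℝ, E) x).map_target hy
    have e := mfderivWithin_symm_eq_chartC hy
    have inv : (mfderiv 𝓘(ℝ, E) 𝓘(ℝ, E) (extChartAt 𝓘(ℝ, E) x).symm y).inverse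
        = chartD x ((extChartAt 𝓘(ℝ, E) x).symm y) := by
      refine ContinuousLinearMap.inverse_eq ?_ ?_
      · ext v
        exact (e _).trans (chartC_chartD hs v)
      · ext v
        exact (congrArg _ (e v)).trans (chartD_chartC hs v)
    change (mfderivWithin 𝓘(ℝ, E) 𝓘(ℝ, E) (extChartAt 𝓘(ℝ, E) x).symm Set.univ y).inverse _ = _
    rw [mfderivWithin_univ]
    exact congrArg (fun l => l (Z ((extChartAt 𝓘(ℝ, E) x).symm y))) inv
  have e1 : @Eq E (bracket X Y x)
      (VectorField.lieBracket ℝ (pull X) (pull Y) (extChartAt 𝓘(ℝ, E) x x)) := by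
    have h := VectorField.mlieBracketWithin_apply (I := 𝓘(ℝ, E)) (V := X) (W := Y)
      (s := Set.univ) (x₀ := x)
    rw [mfderiv_extChartAt_self, ModelWithCorners.range_eq_univ, Set.preimage_univ,
      Set.univ_inter] at h
    refine h.trans (Eq.trans ?_ (congrFun (VectorField.lieBracketWithin_univ (𝕜 := ℝ) (E := E)
      (V := pull X) (W := pull Y)) (extChartAt 𝓘(ℝ, E) x x)))
    exact congrArg (fun l : E →L[ℝ] E => l (VectorField.lieBracketWithin ℝ (pull X) (pull Y)
      Set.univ (extChartAt 𝓘(ℝ, E) x x))) ContinuousLinearMap.inverse_id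
  have e2 : ∀ Z, rep Z (extChartAt 𝓘(ℝ, E) x x) = chartD x x (Z x) := fun Z => by
    change chartD x _ (Z _) = _
    rw [extChartAt_to_inv]
  have hX' : HasFDerivAt (rep X) X' _ := hX
  have hY' : HasFDerivAt (rep Y) Y' _ := hY
  rw [chartD_self, e1, (key X).lieBracket_vectorField_eq (key Y), VectorField.lieBracket,
    hX'.fderiv, hY'.fderiv, e2, e2]

theorem dFun_chartC {x : M} {f : M → ℝ} {f' : E →L[ℝ] ℝ} (hf : HasChartDeriv f f' x) (v : E) :
    dFun E f x (chartC x x v) = f' v := by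
  rw [chartC_self]
  exact congrArg (fun l : E →L[ℝ] ℝ => l v) hf.hasMFDerivAt.mfderiv

/-- The differential of a function that is linear in the preferred chart at `x`. -/
theorem dFun_eq_comp_chartD {x : M} {f : M → ℝ} {ξ : E →L[ℝ] ℝ}
    (hf : f =ᶠ[𝓝 x] fun z => ξ (extChartAt 𝓘(ℝ, E) x z)) :
    ∀ᶠ z in 𝓝 x, ∀ v : TangentSpace 𝓘(ℝ, E) z, dFun E f z v = ξ (chartD x z v) := by
  filter_upwards [hf.eventually_nhds, eventually_mem_chart_source (H := E) x] with z hz hs v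
  have h1 := (mdifferentiableAt_extChartAt (I := 𝓘(ℝ, E)) hs).hasMFDerivAt
  have h2 : HasMFDerivAt 𝓘(ℝ, E) 𝓘(ℝ, ℝ) ξ (extChartAt 𝓘(ℝ, E) x z) ξ :=
    ξ.hasFDerivAt.hasMFDerivAt
  have h3 := ((h2.comp z h1).congr_of_eventuallyEq hz).mfderiv
  rw [← TangentBundle.continuousLinearMapAt_trivializationAt hs] at h3
  exact congrArg (fun l : E →L[ℝ] ℝ => l v) h3

variable [FiniteDimensional ℝ E]

/-- Evaluation on tuples of basis vectors is linear and injective, so it has a linear left inverse,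
continuous in finite dimension: a form depends differentiably on its coefficients. -/
theorem differentiableAt_alternating {p : ℕ} {θ : E → E [⋀^Fin p]→L[ℝ] ℝ} {y : E}
    (h : ∀ w, DifferentiableAt ℝ (fun y => θ y w) y) : DifferentiableAt ℝ θ y := by
  let b := Module.finBasis ℝ E
  let ev : (E [⋀^Fin p]→L[ℝ] ℝ) →ₗ[ℝ] ((Fin p → Fin (Module.finrank ℝ E)) → ℝ) :=
    { toFun := fun a r => a (fun i => b (r i))
      map_add' := fun _ _ => rfl
      map_smul' := fun _ _ => rfl }
  have inj : Function.Injective ev := by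
    intro a a' haa
    have : a.toAlternatingMap = a'.toAlternatingMap :=
      AlternatingMap.coe_multilinearMap_injective <|
        Module.Basis.ext_multilinear (fun _ => b) fun r => congrFun haa r
    exact ContinuousAlternatingMap.toAlternatingMap_injective this
  obtain ⟨l, hl⟩ := LinearMap.exists_leftInverse_of_injective ev (LinearMap.ker_eq_bot.2 inj)
  have e : θ = fun y => l.toContinuousLinearMap (ev (θ y)) := by
    funext y
    exact (congrArg (fun m => m (θ y)) hl).symm
  rw [e]
  exact l.toContinuousLinearMap.differentiableAt.comp y
    (differentiableAt_pi.2 fun r => h fun i => b (r i))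

theorem extD_chartC {p : ℕ} {x : M} {θ : Form E M p} {D : (Fin p → E) → E →L[ℝ] ℝ}
    (h : ∀ w, HasChartDeriv (fun z => θ z (fun i => chartC x z (w i))) (D w) x)
    (v : Fin (p + 1) → E) :
    extD θ x (fun i => chartC x x (v i)) = ∑ i, (-1) ^ i.val * D (i.removeNth v) (v i) := by
  have h' : ∀ w, HasFDerivAt (fun y => θ.inChart x y w) (D w) (extChartAt 𝓘(ℝ, E) x x) := by
    intro w
    refine (h w).congr_of_eventuallyEq ?_
    filter_upwards [extChartAt_target_mem_nhds (I := 𝓘(ℝ, E)) x] with y hy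
    change θ _ _ = θ _ _
    congr 1
    funext i
    exact mfderivWithin_symm_eq_chartC hy (w i)
  have e : extD θ x (fun i => chartC x x (v i))
      = extDeriv (θ.inChart x) (extChartAt 𝓘(ℝ, E) x x) v := by
    change extDeriv (θ.inChart x) (extChartAt 𝓘(ℝ, E) x x) _ = _
    congr 1
    funext i
    change mfderiv 𝓘(ℝ, E) 𝓘(ℝ, E) (extChartAt 𝓘(ℝ, E) x) x (chartC x x (v i)) = v i
    rw [mfderiv_extChartAt_self, chartC_self]
    rfl
  rw [e, extDeriv_apply (differentiableAt_alternating fun w => (h' w).differentiableAt)]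
  refine Finset.sum_congr rfl fun i _ => ?_
  rw [(h' _).fderiv, zsmul_eq_mul]
  push_cast
  rfl

end ChartCalculus

/-! ### Smooth fields with prescribed constant reading near a point -/

section Extension

open Filter Topology

variable {E : Type*} [NormedAddCommGroup E] [NormedSpace ℝ E]
  {M : Type*} [TopologicalSpace M] [ChartedSpace E M] [IsManifold 𝓘(ℝ, E) ∞ M]

theorem SmoothVF.exists_hasChartDeriv {X : VField E M} (hX : SmoothVF X) (x : M) :
    ∃ X' : E →L[ℝ] E, HasChartDeriv (fun z => chartD x z (X z)) X' x := by
  have h := (Bundle.contMDiffAt_section x).1 (hX x)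
  obtain ⟨X', hX'⟩ := hasChartDeriv_of_contMDiffAt h
  refine ⟨X', hX'.congr ?_⟩
  filter_upwards [eventually_mem_chart_source (H := E) x] with z hz
  exact Bundle.Trivialization.continuousLinearMapAt_apply_of_mem ℝ _ (by simpa using hz) _

theorem SmoothFun.smoothCov_dFun {f : M → ℝ} (hf : SmoothFun E f) : SmoothCov (dFun E f) := by
  intro X hX
  have h := (hf.contMDiff_tangentMap (m := ∞) (by simp)).comp hX
  exact (contMDiff_snd_tangentBundle_modelSpace ℝ 𝓘(ℝ, ℝ)).comp h

variable [FiniteDimensional ℝ E] [T2Space M]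

/-- Every vector extends to a smooth vector field that is constant in the chart near `x`. -/
theorem exists_smoothVF_eventually_eq_chartC (x : M) (v : E) :
    ∃ X : VField E M, SmoothVF X ∧ ∀ᶠ z in 𝓝 x, X z = chartC x z v := by
  let ρ : SmoothBumpFunction 𝓘(ℝ, E) x := Classical.arbitrary _
  refine ⟨fun z => ρ z • chartC x z v, ?_, ?_⟩
  · refine ContMDiffOn.smul_section_of_tsupport (s := fun z => chartC x z v)
      ρ.contMDiff.contMDiffOn (chartAt E x).open_source ρ.tsupport_subset_chartAt_source ?_
    refine ((trivializationAt E (TangentSpace 𝓘(ℝ, E)) x).contMDiffOn_section_iff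
      (chartAt E x).open_source (by simp)).2 ?_
    refine (contMDiffOn_const (c := v)).congr fun z hz => ?_
    rw [← Bundle.Trivialization.continuousLinearMapAt_apply_of_mem ℝ _ (by simpa using hz)]
    exact chartD_chartC hz v
  · filter_upwards [ρ.eventuallyEq_one] with z hz
    rw [hz, Pi.one_apply, one_smul]

/-- Every covector is the differential of a smooth function that is linear in the chart. -/
theorem exists_smoothFun_eventually_linear (x : M) (ξ : E →L[ℝ] ℝ) :
    ∃ f : M → ℝ, SmoothFun E f ∧ f =ᶠ[𝓝 x] fun z => ξ (extChartAt 𝓘(ℝ, E) x z) := by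
  let ρ : SmoothBumpFunction 𝓘(ℝ, E) x := Classical.arbitrary _
  refine ⟨fun z => ρ z • ξ (extChartAt 𝓘(ℝ, E) x z), ?_, ?_⟩
  · refine ρ.contMDiff_smul (ξ.contMDiff.comp_contMDiffOn contMDiffOn_extChartAt)
  · filter_upwards [ρ.eventuallyEq_one] with z hz
    rw [hz, Pi.one_apply, one_smul]

end Extension

/-! ### Tensor fields read in a chart -/

section Representatives

variable {E : Type*} [NormedAddCommGroup E] [NormedSpace ℝ E]
  {M : Type*} [TopologicalSpace M] [ChartedSpace E M] [IsManifold 𝓘(ℝ, E) ∞ M]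

/-- The pull-back of a covector of `E` to the tangent space at `z` by the chart at `x`. -/
def chartCov (x z : M) : (E →L[ℝ] ℝ) →ₗ[ℝ] Module.Dual ℝ (TangentSpace 𝓘(ℝ, E) z) where
  toFun ξ := ξ.toLinearMap ∘ₗ (chartD x z).toLinearMap
  map_add' _ _ := rfl
  map_smul' _ _ := rfl

theorem chartCov_apply (x z : M) (ξ : E →L[ℝ] ℝ) (v : TangentSpace 𝓘(ℝ, E) z) :
    chartCov x z ξ v = ξ (chartD x z v) := rfl

variable [FiniteDimensional ℝ E]

/-- A (1,1) tensor field read in the chart at `x`. -/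
def endRep (x : M) (N : EndField E M) (z : M) : E →L[ℝ] E :=
  LinearMap.toContinuousLinearMap
    ((chartD x z).toLinearMap ∘ₗ N z ∘ₗ (chartC x z).toLinearMap)

/-- A bivector field read in the chart at `x`. -/
def bivRep (x : M) (π : BivField E M) (z : M) : (E →L[ℝ] ℝ) →L[ℝ] E :=
  LinearMap.toContinuousLinearMap
    ((chartD x z).toLinearMap ∘ₗ sharp (π z) ∘ₗ chartCov x z)

/-- A 2-form read in the chart at `x`. -/
def formRep (x : M) (Ω : Form E M 2) (z : M) : E →L[ℝ] E →L[ℝ] ℝ :=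
  LinearMap.toContinuousLinearMap
    (LinearMap.toContinuousLinearMap.toLinearMap ∘ₗ (chartC x z).toLinearMap.dualMap ∘ₗ
      flat (Ω z) ∘ₗ (chartC x z).toLinearMap)

theorem endRep_apply (x : M) (N : EndField E M) (z : M) (v : E) :
    endRep x N z v = chartD x z (N z (chartC x z v)) := rfl

theorem bivRep_apply (x : M) (π : BivField E M) (z : M) (ξ : E →L[ℝ] ℝ) :
    bivRep x π z ξ = chartD x z (sharp (π z) (chartCov x z ξ)) := rfl

theorem formRep_apply (x : M) (Ω : Form E M 2) (z : M) (u v : E) :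
    formRep x Ω z u v = Ω z ![chartC x z u, chartC x z v] := rfl

theorem endRep_chartD {x z : M} (hz : z ∈ (chartAt E x).source) (N : EndField E M)
    (v : TangentSpace 𝓘(ℝ, E) z) : endRep x N z (chartD x z v) = chartD x z (N z v) := by
  rw [endRep_apply, chartC_chartD hz]

theorem exists_chartCov_eq {x z : M} (hz : z ∈ (chartAt E x).source)
    (α : Module.Dual ℝ (TangentSpace 𝓘(ℝ, E) z)) :
    chartCov x z (LinearMap.toContinuousLinearMap (α ∘ₗ (chartC x z).toLinearMap)) = α := by
  ext v
  exact congrArg α (chartC_chartD hz v)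

theorem chartD_sharp {x z : M} (hz : z ∈ (chartAt E x).source) (π : BivField E M)
    (α : Module.Dual ℝ (TangentSpace 𝓘(ℝ, E) z)) :
    chartD x z (sharp (π z) α)
      = bivRep x π z (LinearMap.toContinuousLinearMap (α ∘ₗ (chartC x z).toLinearMap)) := by
  rw [bivRep_apply, exists_chartCov_eq hz]

theorem endRep_sharpFlat {x z : M} (hz : z ∈ (chartAt E x).source) (π : BivField E M)
    (Ω : Form E M 2) :
    endRep x (sharpFlat π Ω) z = (bivRep x π z).comp (formRep x Ω z) := by
  ext v
  rw [endRep_apply, sharpFlat, LinearMap.comp_apply, chartD_sharp hz]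
  rfl

theorem bivRep_skew {π : BivField E M} (hπ : ∀ x, (π x).IsAlt) (x z : M) (ξ η : E →L[ℝ] ℝ) :
    η (bivRep x π z ξ) = -ξ (bivRep x π z η) :=
  sharp_skew (hπ z) (chartCov x z ξ) (chartCov x z η)

theorem formRep_skew (x : M) (Ω : Form E M 2) (z : M) (u v : E) :
    formRep x Ω z u v = -formRep x Ω z v u :=
  alt_two_swap _ _ _

end Representatives

/-! ### Smooth tensor fields have differentiable readings -/

section Differentiability

open Filter Topology

theorem differentiableAt_of_dual {E F : Type*} [NormedAddCommGroup E] [NormedSpace ℝ E]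
    [NormedAddCommGroup F] [NormedSpace ℝ F] [FiniteDimensional ℝ F] {f : E → F} {y : E}
    (h : ∀ η : F →L[ℝ] ℝ, DifferentiableAt ℝ (fun y => η (f y)) y) : DifferentiableAt ℝ f y := by
  let b := Module.finBasis ℝ F
  have e : f = fun y => ∑ i, LinearMap.toContinuousLinearMap (b.coord i) (f y) • b i := by
    funext y
    exact (b.sum_repr (f y)).symm
  rw [e]
  exact DifferentiableAt.fun_sum fun i _ => (h _).smul_const _

theorem differentiableAt_of_apply {E F G : Type*} [NormedAddCommGroup E] [NormedSpace ℝ E]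
    [NormedAddCommGroup F] [NormedSpace ℝ F] [FiniteDimensional ℝ F]
    [NormedAddCommGroup G] [NormedSpace ℝ G] {f : E → F →L[ℝ] G} {y : E}
    (h : ∀ v, DifferentiableAt ℝ (fun y => f y v) y) : DifferentiableAt ℝ f y := by
  let b := Module.finBasis ℝ F
  have e : f = fun y => ∑ i, ContinuousLinearMap.smulRightL ℝ F G
      (LinearMap.toContinuousLinearMap (b.coord i)) (f y (b i)) := by
    funext y
    ext v
    have hv : f y v = ∑ i, b.repr v i • f y (b i) := by
      conv_lhs => rw [← b.sum_repr v]
      simp only [map_sum, map_smul]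
    rw [hv]
    simp [_root_.sum_apply]
  rw [e]
  exact DifferentiableAt.fun_sum fun i _ =>
    (ContinuousLinearMap.smulRightL ℝ F G _).differentiableAt.comp y (h _)

variable {E : Type*} [NormedAddCommGroup E] [NormedSpace ℝ E] [FiniteDimensional ℝ E]
  {M : Type*} [TopologicalSpace M] [ChartedSpace E M] [IsManifold 𝓘(ℝ, E) ∞ M] [T2Space M]

theorem SmoothEnd.exists_hasChartDeriv {N : EndField E M} (hN : SmoothEnd N) (x : M) :
    ∃ N' : E →L[ℝ] E →L[ℝ] E, HasChartDeriv (endRep x N) N' x := by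
  refine ⟨_, (differentiableAt_of_apply fun v => ?_).hasFDerivAt⟩
  obtain ⟨X, hX, hXv⟩ := exists_smoothVF_eventually_eq_chartC x v
  obtain ⟨D, hD⟩ := (hN X hX).exists_hasChartDeriv x
  refine HasFDerivAt.differentiableAt (hD.congr (g := fun z => endRep x N z v) ?_)
  filter_upwards [hXv] with z hz
  rw [hz, endRep_apply]

theorem SmoothForm.exists_hasChartDeriv {Ω : Form E M 2} (hΩ : SmoothForm Ω) (x : M) :
    ∃ Ω' : E →L[ℝ] E →L[ℝ] E →L[ℝ] ℝ, HasChartDeriv (formRep x Ω) Ω' x := by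
  refine ⟨_, (differentiableAt_of_apply fun u => differentiableAt_of_apply fun v => ?_).hasFDerivAt⟩
  obtain ⟨X, hX, hXu⟩ := exists_smoothVF_eventually_eq_chartC x u
  obtain ⟨Y, hY, hYv⟩ := exists_smoothVF_eventually_eq_chartC x v
  have h := hΩ ![X, Y] (by intro i; fin_cases i <;> assumption)
  obtain ⟨D, hD⟩ := hasChartDeriv_of_contMDiffAt (h x)
  refine HasFDerivAt.differentiableAt (hD.congr (g := fun z => formRep x Ω z u v) ?_)
  filter_upwards [hXu, hYv] with z hz hz'
  rw [formRep_apply, ← hz, ← hz']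
  congr 1
  ext i
  fin_cases i <;> rfl

/-- Every covector extends to a smooth 1-form that is constant in the chart near `x`. -/
theorem exists_smoothCov_eventually_eq_chartCov (x : M) (ξ : E →L[ℝ] ℝ) :
    ∃ f : M → ℝ, SmoothFun E f ∧ ∀ᶠ z in 𝓝 x, dFun E f z = chartCov x z ξ := by
  obtain ⟨f, hf, hfξ⟩ := exists_smoothFun_eventually_linear x ξ
  refine ⟨f, hf, ?_⟩
  filter_upwards [dFun_eq_comp_chartD hfξ] with z hz
  ext v
  exact hz v

theorem SmoothBiv.exists_hasChartDeriv {π : BivField E M} (hπ : SmoothBiv π) (x : M) :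
    ∃ π' : E →L[ℝ] (E →L[ℝ] ℝ) →L[ℝ] E, HasChartDeriv (bivRep x π) π' x := by
  refine ⟨_, (differentiableAt_of_apply fun ξ => differentiableAt_of_dual fun η => ?_).hasFDerivAt⟩
  obtain ⟨f, hf, hfξ⟩ := exists_smoothCov_eventually_eq_chartCov x ξ
  obtain ⟨g, hg, hgη⟩ := exists_smoothCov_eventually_eq_chartCov x η
  obtain ⟨D, hD⟩ := hasChartDeriv_of_contMDiffAt (hπ _ _ hf.smoothCov_dFun hg.smoothCov_dFun x)
  refine HasFDerivAt.differentiableAt (hD.congr (g := fun z => η (bivRep x π z ξ)) ?_)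
  filter_upwards [hfξ, hgη] with z hz hz'
  rw [hz, hz', ← apply_sharp]
  rfl

end Differentiability

/-! ### The hypotheses as identities between first derivatives at a point -/

section Jets

open Filter Topology

variable {E : Type*} [NormedAddCommGroup E] [NormedSpace ℝ E]
  {M : Type*} [TopologicalSpace M] [ChartedSpace E M]

theorem HasChartDeriv.clm_apply {F G : Type*} [NormedAddCommGroup F] [NormedSpace ℝ F]
    [NormedAddCommGroup G] [NormedSpace ℝ G] {f : M → F →L[ℝ] G} {f' : E →L[ℝ] F →L[ℝ] G}
    {u : M → F} {u' : E →L[ℝ] F} {x : M} (hf : HasChartDeriv f f' x) (hu : HasChartDeriv u u' x) :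
    HasChartDeriv (fun z => f z (u z)) ((f x).comp u' + f'.flip (u x)) x := by
  have := HasFDerivAt.clm_apply hf hu
  simp only [extChartAt_to_inv] at this
  exact this

theorem HasChartDeriv.clm_comp {F G H : Type*} [NormedAddCommGroup F] [NormedSpace ℝ F]
    [NormedAddCommGroup G] [NormedSpace ℝ G] [NormedAddCommGroup H] [NormedSpace ℝ H]
    {f : M → G →L[ℝ] H} {f' : E →L[ℝ] G →L[ℝ] H} {g : M → F →L[ℝ] G} {g' : E →L[ℝ] F →L[ℝ] G}
    {x : M} (hf : HasChartDeriv f f' x) (hg : HasChartDeriv g g' x) :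
    HasChartDeriv (fun z => (f z).comp (g z)) ((ContinuousLinearMap.compL ℝ F G H (f x)).comp g'
      + ((ContinuousLinearMap.compL ℝ F G H).flip (g x)).comp f') x := by
  have := HasFDerivAt.clm_comp hf hg
  simp only [extChartAt_to_inv] at this
  exact this

theorem HasChartDeriv.mul {f g : M → ℝ} {f' g' : E →L[ℝ] ℝ} {x : M} (hf : HasChartDeriv f f' x)
    (hg : HasChartDeriv g g' x) : HasChartDeriv (fun z => f z * g z) (f x • g' + g x • f') x := by
  have := HasFDerivAt.fun_mul hf hg
  simp only [extChartAt_to_inv] at this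
  exact this

theorem HasChartDeriv.add {F : Type*} [NormedAddCommGroup F] [NormedSpace ℝ F]
    {f g : M → F} {f' g' : E →L[ℝ] F} {x : M} (hf : HasChartDeriv f f' x)
    (hg : HasChartDeriv g g' x) : HasChartDeriv (fun z => f z + g z) (f' + g') x :=
  HasFDerivAt.fun_add hf hg

theorem HasChartDeriv.sub {F : Type*} [NormedAddCommGroup F] [NormedSpace ℝ F]
    {f g : M → F} {f' g' : E →L[ℝ] F} {x : M} (hf : HasChartDeriv f f' x)
    (hg : HasChartDeriv g g' x) : HasChartDeriv (fun z => f z - g z) (f' - g') x :=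
  HasFDerivAt.fun_sub hf hg

theorem HasChartDeriv.const_mul {f : M → ℝ} {f' : E →L[ℝ] ℝ} {x : M} (hf : HasChartDeriv f f' x)
    (c : ℝ) : HasChartDeriv (fun z => c * f z) (c • f') x :=
  HasFDerivAt.const_mul hf c

theorem HasChartDeriv.apply {F G : Type*} [NormedAddCommGroup F] [NormedSpace ℝ F]
    [NormedAddCommGroup G] [NormedSpace ℝ G] {f : M → F →L[ℝ] G} {f' : E →L[ℝ] F →L[ℝ] G} {x : M}
    (h : HasChartDeriv f f' x) (v : F) : HasChartDeriv (fun z => f z v) (f'.flip v) x := by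
  have := HasFDerivAt.clm_apply h (hasFDerivAt_const v _)
  simpa [HasChartDeriv] using! this

theorem HasChartDeriv.clm {F G : Type*} [NormedAddCommGroup F] [NormedSpace ℝ F]
    [NormedAddCommGroup G] [NormedSpace ℝ G] {f : M → F} {f' : E →L[ℝ] F} {x : M}
    (h : HasChartDeriv f f' x) (l : F →L[ℝ] G) :
    HasChartDeriv (fun z => l (f z)) (l.comp f') x :=
  l.hasFDerivAt.comp _ h

theorem hasChartDeriv_const {F : Type*} [NormedAddCommGroup F] [NormedSpace ℝ F] (c : F) (x : M) :
    HasChartDeriv (fun _ : M => c) (0 : E →L[ℝ] F) x :=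
  hasFDerivAt_const c _

theorem HasChartDeriv.neg {F : Type*} [NormedAddCommGroup F] [NormedSpace ℝ F]
    {f : M → F} {f' : E →L[ℝ] F} {x : M} (h : HasChartDeriv f f' x) :
    HasChartDeriv (fun z => -f z) (-f') x :=
  HasFDerivAt.fun_neg h

variable [IsManifold 𝓘(ℝ, E) ∞ M] [FiniteDimensional ℝ E]

/-- In Cartan's formula the derivative of X enters only through that of α(X), so X is otherwise
needed only at x. -/
theorem lieCov_chartC {x : M} {X : VField E M} {α : CovField E M} {D : E → E →L[ℝ] ℝ}
    {f' : E →L[ℝ] ℝ} (hα : ∀ w, HasChartDeriv (fun z => α z (chartC x z w)) (D w) x)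
    (hf : HasChartDeriv (fun z => α z (X z)) f' x) {v : E} (hX : X x = chartC x x v) (w : E) :
    lieCov X α x (chartC x x w) = D w v - D v w + f' w := by
  have h1 := extD_chartC (θ := α.toForm) (D := fun w => D (w 0)) (fun w => hα (w 0)) ![v, w]
  have h2 := dFun_chartC hf w
  have e : (fun i => chartC x x (![v, w] i)) = ![X x, chartC x x w] := by
    rw [hX]; ext i; fin_cases i <;> rfl
  rw [e, Fin.sum_univ_two] at h1
  change extD α.toForm x ![X x, chartC x x w] + dFun E _ x _ = _
  rw [h1, h2]
  simp [Fin.removeNth]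
  ring

theorem IsPoisson.deriv_bivRep_skew [T2Space M] {π : BivField E M} (hπ : IsPoisson π) {x : M}
    {dP : E →L[ℝ] (E →L[ℝ] ℝ) →L[ℝ] E} (hP : HasChartDeriv (bivRep x π) dP x)
    (u : E) (ξ η : E →L[ℝ] ℝ) : η (dP u ξ) = -ξ (dP u η) := by
  have h1 := (hP.apply ξ).clm η
  have h2 := ((hP.apply η).clm ξ).neg
  have h3 := h1.unique (h2.congr (Eventually.of_forall fun z => bivRep_skew hπ.alt x z ξ η))
  exact congrArg (fun l : E →L[ℝ] ℝ => l u) h3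

theorem deriv_formRep_skew {Ω : Form E M 2} {x : M} {dO : E →L[ℝ] E →L[ℝ] E →L[ℝ] ℝ}
    (hO : HasChartDeriv (formRep x Ω) dO x) (w u v : E) : dO w u v = -dO w v u := by
  have h1 := (hO.apply u).apply v
  have h2 := ((hO.apply v).apply u).neg
  have h3 := h1.unique (h2.congr (Eventually.of_forall fun z => formRep_skew x Ω z u v))
  exact congrArg (fun l : E →L[ℝ] ℝ => l w) h3

theorem deriv_formRep_cyclic {Ω : Form E M 2} (hΩ : extD Ω = 0) {x : M}
    {dO : E →L[ℝ] E →L[ℝ] E →L[ℝ] ℝ} (hO : HasChartDeriv (formRep x Ω) dO x) (u v w : E) :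
    dO u v w + dO v w u + dO w u v = 0 := by
  have h := extD_chartC (θ := Ω) (D := fun w => (dO.flip (w 0)).flip (w 1)) (fun w => by
    refine ((hO.apply (w 0)).apply (w 1)).congr (Eventually.of_forall fun z => ?_)
    change Ω z _ = Ω z _
    congr 1
    ext i
    fin_cases i <;> rfl) ![u, v, w]
  rw [hΩ, Fin.sum_univ_three] at h
  simp [Fin.removeNth, Fin.succAbove] at h
  have h3 := deriv_formRep_skew hO v u w
  linarith

theorem IsPoisson.deriv_bivRep_jacobi [T2Space M] {π : BivField E M} (hπ : IsPoisson π) {x : M}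
    {dP : E →L[ℝ] (E →L[ℝ] ℝ) →L[ℝ] E} (hP : HasChartDeriv (bivRep x π) dP x)
    (ξ η ζ : E →L[ℝ] ℝ) :
    ζ (dP (bivRep x π x ξ) η) + ξ (dP (bivRep x π x η) ζ) + η (dP (bivRep x π x ζ) ξ) = 0 := by
  have hx := mem_chart_source E x
  -- For functions linear in the chart the second derivatives vanish, so an iterated bracket
  -- involves only the derivative of π.
  have key : ∀ (f g h : M → ℝ) (ξ η ζ : E →L[ℝ] ℝ),
      (∀ᶠ z in 𝓝 x, dFun E f z = chartCov x z ξ) → (∀ᶠ z in 𝓝 x, dFun E g z = chartCov x z η) →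
      (∀ᶠ z in 𝓝 x, dFun E h z = chartCov x z ζ) →
      poissonBracket π f (poissonBracket π g h) x = ζ (dP (bivRep x π x ξ) η) := by
    intro f g h ξ η ζ hf hg hh
    have h1 : HasChartDeriv (poissonBracket π g h) (η.comp (dP.flip ζ)) x := by
      refine ((hP.apply ζ).clm η).congr ?_
      filter_upwards [hg, hh] with z hz hz'
      rw [poissonBracket, hz, hz']
      rfl
    have h2 : dFun E (poissonBracket π g h) x = chartCov x x (η.comp (dP.flip ζ)) := by
      ext v
      rw [← chartC_chartD hx v, dFun_chartC h1, chartCov_apply, chartD_chartC hx]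
    rw [poissonBracket, h2, hf.self_of_nhds, chartCov_apply, ← bivRep_apply,
      bivRep_skew hπ.alt, hπ.deriv_bivRep_skew hP _ η ζ]
    rfl
  obtain ⟨f, hf, hfξ⟩ := exists_smoothCov_eventually_eq_chartCov x ξ
  obtain ⟨g, hg, hgη⟩ := exists_smoothCov_eventually_eq_chartCov x η
  obtain ⟨h, hh, hhζ⟩ := exists_smoothCov_eventually_eq_chartCov x ζ
  have j := congrFun (hπ.jacobi f g h hf hg hh) x
  simp only [Pi.add_apply, Pi.zero_apply] at j
  rw [key f g h ξ η ζ hfξ hgη hhζ, key g h f η ζ ξ hgη hhζ hfξ, key h f g ζ ξ η hhζ hfξ hgη] at j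
  exact j

theorem IsPN.deriv_endRep_torsion [T2Space M] {π : BivField E M} {N : EndField E M}
    (h : IsPN π N) {x : M} {dN : E →L[ℝ] E →L[ℝ] E} (hN : HasChartDeriv (endRep x N) dN x)
    (u v : E) :
    dN (endRep x N x u) v - dN (endRep x N x v) u - endRep x N x (dN u v)
      + endRep x N x (dN v u) = 0 := by
  have hx := mem_chart_source E x
  obtain ⟨X, hX, hXu⟩ := exists_smoothVF_eventually_eq_chartC x u
  obtain ⟨Y, hY, hYv⟩ := exists_smoothVF_eventually_eq_chartC x v
  have c : ∀ (Z : VField E M) (w : E), (∀ᶠ z in 𝓝 x, Z z = chartC x z w) →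
      HasChartDeriv (fun z => chartD x z (Z z)) (0 : E →L[ℝ] E) x := fun Z w hZ => by
    refine (hasChartDeriv_const w x).congr ?_
    filter_upwards [hZ, eventually_mem_chart_source (H := E) x] with z hz hs
    rw [hz, chartD_chartC hs]
  have d : ∀ (Z : VField E M) (w : E), (∀ᶠ z in 𝓝 x, Z z = chartC x z w) →
      HasChartDeriv (fun z => chartD x z (N z (Z z))) (dN.flip w) x := fun Z w hZ => by
    refine (hN.apply w).congr ?_
    filter_upwards [hZ] with z hz
    rw [hz, endRep_apply]
  have t := congrArg (chartD x x) (congrFun (h.torsion_eq_zero X Y hX hY) x)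
  have b1 := chartD_bracket (d X u hXu) (d Y v hYv)
  have b2 := chartD_bracket (d X u hXu) (c Y v hYv)
  have b3 := chartD_bracket (c X u hXu) (d Y v hYv)
  have b4 := chartD_bracket (c X u hXu) (c Y v hYv)
  rw [torsion, map_sub, ← endRep_chartD hx, map_sub, map_add, ← endRep_chartD hx, b1, b2, b3, b4,
    ← endRep_chartD hx, ← endRep_chartD hx, hXu.self_of_nhds, hYv.self_of_nhds,
    chartD_chartC hx, chartD_chartC hx] at t
  simp only [Pi.zero_apply, map_zero, _root_.zero_apply, sub_zero, zero_sub,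
    ContinuousLinearMap.flip_apply, map_add, map_neg] at t
  rw [← t]
  abel

/-- The concomitant is tested on a vector field and an exact 1-form, both constant in the chart near
x, so that only π and N are differentiated. Pairing with ζ and using skew-symmetry evaluates the Lie
derivatives at Pζ. -/
theorem IsPN.compatibleJet [T2Space M] {π : BivField E M} {N : EndField E M} (h : IsPN π N)
    {Ω : Form E M 2} (hΩ : extD Ω = 0) {x : M} {dP : E →L[ℝ] (E →L[ℝ] ℝ) →L[ℝ] E}
    {dO : E →L[ℝ] E →L[ℝ] E →L[ℝ] ℝ} {dN : E →L[ℝ] E →L[ℝ] E}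
    (hP : HasChartDeriv (bivRep x π) dP x) (hO : HasChartDeriv (formRep x Ω) dO x)
    (hN : HasChartDeriv (endRep x N) dN x) :
    CompatibleJet (bivRep x π x) dP (formRep x Ω x) dO (endRep x N x) (fun u v => dN u v) where
  skew := bivRep_skew h.poisson.alt x x
  form_skew := formRep_skew x Ω x
  form_dskew := deriv_formRep_skew hO
  closed := deriv_formRep_cyclic hΩ hO
  comm ξ := by
    have hx := mem_chart_source E x
    rw [bivRep_apply, endRep_chartD hx, ← LinearMap.comp_apply, h.compatible.comm x,
      LinearMap.comp_apply, chartD_sharp hx]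
    congr 1
  concomitant ξ v ζ := by
    have hx := mem_chart_source E x
    obtain ⟨X, hX, hXv⟩ := exists_smoothVF_eventually_eq_chartC x v
    obtain ⟨f, hf, hfξ⟩ := exists_smoothCov_eventually_eq_chartCov x ξ
    have c := congrArg (chartCov x x ζ) (h.compatible.concomitant (dFun E f) X hf.smoothCov_dFun hX x)
    have d1 : HasChartDeriv (fun z => chartD x z (X z)) (0 : E →L[ℝ] E) x := by
      refine (hasChartDeriv_const v x).congr ?_
      filter_upwards [hXv, eventually_mem_chart_source (H := E) x] with z hz hs
      rw [hz, chartD_chartC hs]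
    have d2 : HasChartDeriv (fun z => chartD x z (N z (X z))) (dN.flip v) x := by
      refine (hN.apply v).congr ?_
      filter_upwards [hXv] with z hz
      rw [hz, endRep_apply]
    have d3 : HasChartDeriv (fun z => chartD x z (sharp (π z) (dFun E f z))) (dP.flip ξ) x := by
      refine (hP.apply ξ).congr ?_
      filter_upwards [hfξ] with z hz
      rw [hz, bivRep_apply]
    have d4 : HasChartDeriv (fun z => dFun E f z (N z (X z))) (ξ.comp (dN.flip v)) x := by
      refine (d2.clm ξ).congr ?_
      filter_upwards [hfξ] with z hz
      rw [hz, chartCov_apply]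
    have d5 : ∀ w, HasChartDeriv (fun z => (N z).dualMap (dFun E f z) (chartC x z w))
        (ξ.comp (dN.flip w)) x := fun w => by
      refine ((hN.apply w).clm ξ).congr ?_
      filter_upwards [hfξ] with z hz
      rw [hz]
      rfl
    have d6 : ∀ w, HasChartDeriv (fun z => dFun E f z (chartC x z w)) (0 : E →L[ℝ] ℝ) x := fun w => by
      refine (hasChartDeriv_const (ξ w) x).congr ?_
      filter_upwards [hfξ, eventually_mem_chart_source (H := E) x] with z hz hs
      rw [hz, chartCov_apply, chartD_chartC hs]
    have b1 := chartD_bracket d3 d2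
    have b2 := chartD_bracket d3 d1
    have l1 := lieCov_chartC d5 d4 hXv.self_of_nhds (chartD x x (sharp (π x) (chartCov x x ζ)))
    have l2 := lieCov_chartC (X := fun y => N y (X y)) (v := chartD x x (N x (X x))) d6 d4
      (chartC_chartD hx _).symm (chartD x x (sharp (π x) (chartCov x x ζ)))
    rw [chartC_chartD hx] at l1 l2
    rw [map_add, map_sub, sharp_skew (h.poisson.alt x) (lieCov X _ x),
      sharp_skew (h.poisson.alt x) (lieCov _ (dFun E f) x), l1, l2, chartCov_apply, lieEnd, map_sub, ← endRep_chartD hx, b1, b2, hfξ.self_of_nhds,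
      ← bivRep_apply, ← bivRep_apply, ← endRep_chartD hx, hXv.self_of_nhds, chartD_chartC hx] at c
    simp only [map_zero, _root_.zero_apply, zero_sub, sub_zero, ContinuousLinearMap.flip_apply,
      ContinuousLinearMap.comp_apply, map_sub, map_neg, zero_add] at c
    linarith

end Jets

/-! ### The Koszul bracket of a closed 2-form with itself, and φ_+ -/

section Koszul

open Filter Topology

variable {E : Type*} [NormedAddCommGroup E] [NormedSpace ℝ E] [FiniteDimensional ℝ E]
  {M : Type*} [TopologicalSpace M] [ChartedSpace E M] [IsManifold 𝓘(ℝ, E) ∞ M]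

theorem form_two_chartC (x : M) (Ω : Form E M 2) (z : M) (w : Fin 2 → E) :
    Ω z (fun i => chartC x z (w i)) = formRep x Ω z (w 0) (w 1) := by
  rw [formRep_apply]
  congr 1
  ext i
  fin_cases i <;> rfl

theorem iEnd_chartC {x z : M} (hz : z ∈ (chartAt E x).source) (B : EndField E M) (Ω : Form E M 2)
    (a b : E) : formRep x (iEnd B Ω) z a b
      = formRep x Ω z (endRep x B z a) b + formRep x Ω z a (endRep x B z b) := by
  simp only [formRep_apply, endRep_apply, chartC_chartD hz]
  exact insertEndAlt_two _ _ _ _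

theorem hasChartDeriv_iEnd {x : M} {B : EndField E M} {Ω : Form E M 2}
    {dO : E →L[ℝ] E →L[ℝ] E →L[ℝ] ℝ} {dB : E →L[ℝ] E →L[ℝ] E}
    (hO : HasChartDeriv (formRep x Ω) dO x) (hB : HasChartDeriv (endRep x B) dB x) (a b : E) :
    ∃ l : E →L[ℝ] ℝ, HasChartDeriv (fun z => formRep x (iEnd B Ω) z a b) l x ∧
      ∀ u, l u = insertDeriv (formRep x Ω x) dO (endRep x B x) (fun u v => dB u v) u a b := by
  have h1 := (hO.clm_apply (hB.apply a)).apply b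
  have h2 := (hO.apply a).clm_apply (hB.apply b)
  refine ⟨_, (h1.add h2).congr ?_, fun u => ?_⟩
  · filter_upwards [eventually_mem_chart_source (H := E) x] with z hz
    exact iEnd_chartC hz B Ω a b
  · simp [insertDeriv]
    ring

theorem extD_iEnd {x : M} {B : EndField E M} {Ω : Form E M 2}
    {dO : E →L[ℝ] E →L[ℝ] E →L[ℝ] ℝ} {dB : E →L[ℝ] E →L[ℝ] E}
    (hO : HasChartDeriv (formRep x Ω) dO x) (hB : HasChartDeriv (endRep x B) dB x) (v : Fin 3 → E) :
    extD (iEnd B Ω) x (fun i => chartC x x (v i))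
      = insertDeriv (formRep x Ω x) dO (endRep x B x) (fun u v => dB u v) (v 0) (v 1) (v 2)
        - insertDeriv (formRep x Ω x) dO (endRep x B x) (fun u v => dB u v) (v 1) (v 0) (v 2)
        + insertDeriv (formRep x Ω x) dO (endRep x B x) (fun u v => dB u v) (v 2) (v 0) (v 1) := by
  choose l hl hl' using hasChartDeriv_iEnd hO hB
  have h := extD_chartC (θ := iEnd B Ω) (D := fun w => l (w 0) (w 1))
    (fun w => (hl (w 0) (w 1)).congr (Eventually.of_forall fun z => form_two_chartC x _ z w)) v
  rw [h, Fin.sum_univ_three]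
  simp [Fin.removeNth, Fin.succAbove, hl']
  ring

theorem extD_wedge_self {Ω : Form E M 2} (hΩ : extD Ω = 0) {x : M}
    {dO : E →L[ℝ] E →L[ℝ] E →L[ℝ] ℝ} (hO : HasChartDeriv (formRep x Ω) dO x) :
    extD (Ω.wedge Ω) x = 0 := by
  have hx := mem_chart_source E x
  have hw : ∀ w : Fin 4 → E, ∃ l : E →L[ℝ] ℝ,
      HasChartDeriv (fun z => Ω.wedge Ω z (fun i => chartC x z (w i))) l x ∧
      ∀ u, l u = 2 * (dO u (w 0) (w 1) * formRep x Ω x (w 2) (w 3)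
        + formRep x Ω x (w 0) (w 1) * dO u (w 2) (w 3)
        - (dO u (w 0) (w 2) * formRep x Ω x (w 1) (w 3)
        + formRep x Ω x (w 0) (w 2) * dO u (w 1) (w 3))
        + (dO u (w 0) (w 3) * formRep x Ω x (w 1) (w 2)
        + formRep x Ω x (w 0) (w 3) * dO u (w 1) (w 2))) := by
    intro w
    have h := fun i j => (hO.apply (w i)).apply (w j)
    have h' := ((((h 0 1).mul (h 2 3)).sub ((h 0 2).mul (h 1 3))).add
      ((h 0 3).mul (h 1 2))).const_mul 2
    refine ⟨_, h'.congr (Eventually.of_forall fun z => ?_), fun u => ?_⟩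
    · exact wedgeAlt_two_two_self (Ω z) _
    · simp
      ring
  choose l hl hl' using hw
  ext v
  obtain ⟨v, rfl⟩ : ∃ v' : Fin 5 → E, v = fun i => chartC x x (v' i) :=
    ⟨fun i => chartD x x (v i), by ext i; exact (chartC_chartD hx _).symm⟩
  refine (extD_chartC hl v).trans ?_
  rw [Fin.sum_univ_five]
  have c : ∀ i j k, dO (v i) (v j) (v k) - dO (v j) (v i) (v k) + dO (v k) (v i) (v j) = 0 :=
    fun i j k => by
      have := deriv_formRep_cyclic hΩ hO (v i) (v j) (v k)
      rwa [deriv_formRep_skew hO (v j) (v k), ← sub_eq_add_neg] at this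
  have t0 : Fin.tail v 0 = v 1 := rfl
  have t1 : Fin.tail v 1 = v 2 := rfl
  have t2 : Fin.tail v 2 = v 3 := rfl
  have t3 : Fin.tail v 3 = v 4 := rfl
  simp [Fin.removeNth, Fin.succAbove, hl', t0, t1, t2, t3]
  generalize formRep x Ω x = o
  -- This is d(Ω ∧ Ω) = 2 dΩ ∧ Ω: one closedness relation for each of the ten choices of three among
  -- five vectors, with the sign of the shuffle.
  linear_combination 2 * (o (v 3) (v 4) * c 0 1 2 - o (v 2) (v 4) * c 0 1 3
    + o (v 2) (v 3) * c 0 1 4 + o (v 1) (v 4) * c 0 2 3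
    - o (v 1) (v 3) * c 0 2 4 + o (v 1) (v 2) * c 0 3 4
    - o (v 0) (v 4) * c 1 2 3 + o (v 0) (v 3) * c 1 2 4
    - o (v 0) (v 2) * c 1 3 4 + o (v 0) (v 1) * c 2 3 4)

/-- The trace as a continuous linear functional. -/
def traceL (E : Type*) [NormedAddCommGroup E] [NormedSpace ℝ E] [FiniteDimensional ℝ E] :
    (E →L[ℝ] E) →L[ℝ] ℝ :=
  LinearMap.toContinuousLinearMap
    (LinearMap.trace ℝ E ∘ₗ ContinuousLinearMap.coeLM ℝ)

theorem trace_pow_eq_traceL {x z : M} (hz : z ∈ (chartAt E x).source) (B : EndField E M) (k : ℕ) :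
    LinearMap.trace ℝ (TangentSpace 𝓘(ℝ, E) z) (B z ^ k) = traceL E (endRep x B z ^ k) := by
  let e : E ≃ₗ[ℝ] TangentSpace 𝓘(ℝ, E) z := LinearEquiv.ofLinearMap (chartC x z).toLinearMap
    (chartD x z).toLinearMap (by ext v; exact chartC_chartD hz v)
    (by ext v; exact chartD_chartC hz v)
  have h : B z = e.conj (endRep x B z).toLinearMap := by
    ext v
    exact ((chartC_chartD hz _).symm.trans (congrArg _ (endRep_chartD hz B v).symm))
  have hk : B z ^ k = e.conj (endRep x B z ^ k).toLinearMap := by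
    induction k with
    | zero => ext v; exact (e.apply_symm_apply v).symm
    | succ k ih => rw [pow_succ, ih, h, Module.End.mul_eq_comp, ← LinearEquiv.conj_comp, pow_succ]; rfl
  rw [hk, LinearMap.trace_conj']
  rfl

theorem hasChartDeriv_trace {x : M} {B : EndField E M} {dB : E →L[ℝ] E →L[ℝ] E}
    (hB : HasChartDeriv (endRep x B) dB x) :
    HasChartDeriv (fun z => LinearMap.trace ℝ (TangentSpace 𝓘(ℝ, E) z) (B z))
      ((traceL E).comp dB) x := by
  refine (hB.clm (traceL E)).congr ?_
  filter_upwards [eventually_mem_chart_source (H := E) x] with z hz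
  simpa using trace_pow_eq_traceL hz B 1

variable {π : BivField E M} {Ω : Form E M 2} {x : M} {dO : E →L[ℝ] E →L[ℝ] E →L[ℝ] ℝ}
  {dA : E →L[ℝ] E →L[ℝ] E}

theorem koszulDelta_two_chartC (hπ : ∀ x, (π x).IsAlt) (hΩ : extD Ω = 0)
    (hA : HasChartDeriv (endRep x (sharpFlat π Ω)) dA x) (v : Fin 1 → E) :
    koszulDelta π (p := 1) Ω x (fun i => chartC x x (v i))
      = (1 / 2) * traceL E (dA (v 0)) := by
  have h := extD_chartC (θ := iBiv π (p := 0) Ω) (D := fun _ => (-(1 / 2) : ℝ) • (traceL E).comp dA)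
    (fun w => ((hasChartDeriv_trace hA).const_mul (-(1 / 2))).congr
      (Eventually.of_forall fun z => insertBivectorAlt_two (hπ z) (Ω z) _)) v
  have e : koszulDelta π (p := 1) Ω x (fun i => chartC x x (v i))
      = insertBivectorAlt (π x) (extD Ω x) (fun i => chartC x x (v i))
        - extD (iBiv π (p := 0) Ω) x (fun i => chartC x x (v i)) := rfl
  rw [e, h, hΩ, Pi.zero_apply, insertBivectorAlt_zero]
  simp

theorem koszulDelta_wedge_self_chartC (hπ : ∀ x, (π x).IsAlt) (hΩ : extD Ω = 0)
    (hO : HasChartDeriv (formRep x Ω) dO x)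
    (hA : HasChartDeriv (endRep x (sharpFlat π Ω)) dA x) (v : Fin 3 → E) :
    koszulDelta π (p := 3) (Ω.wedge Ω) x (fun i => chartC x x (v i))
      = traceL E (dA (v 0)) * formRep x Ω x (v 1) (v 2)
        - traceL E (dA (v 1)) * formRep x Ω x (v 0) (v 2)
        + traceL E (dA (v 2)) * formRep x Ω x (v 0) (v 1)
        - extD (iEnd (sharpFlat π Ω) Ω) x (fun i => chartC x x (v i)) := by
  choose l hl hl' using hasChartDeriv_iEnd hO hA
  have hσ := hasChartDeriv_trace hA
  have h := extD_chartC (θ := iBiv π (p := 2) (Ω.wedge Ω)) (fun w =>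
    ((hσ.neg.mul ((hO.apply (w 0)).apply (w 1))).add (hl (w 0) (w 1))).congr
      (Eventually.of_forall fun z => by
        change insertBivectorAlt (p := 2) (π z) (wedgeAlt (Ω z) (Ω z)) _ = _
        rw [insertBivectorAlt_wedge_self (hπ z), AlternatingMap.add_apply,
          AlternatingMap.smul_apply, form_two_chartC, smul_eq_mul]
        exact congrArg _ (form_two_chartC x (iEnd (sharpFlat π Ω) Ω) z w))) v
  have e : koszulDelta π (p := 3) (Ω.wedge Ω) x (fun i => chartC x x (v i))
      = insertBivectorAlt (p := 3) (π x) (extD (Ω.wedge Ω) x) (fun i => chartC x x (v i))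
        - extD (iBiv π (p := 2) (Ω.wedge Ω)) x (fun i => chartC x x (v i)) := rfl
  rw [e, h, extD_wedge_self hΩ hO, extD_iEnd hO hA]
  have z := congrArg (fun a => a (fun i => chartC x x (v i)))
    (insertBivectorAlt_zero (p := 3) (π x))
  have c := deriv_formRep_cyclic hΩ hO (v 0) (v 1) (v 2)
  rw [deriv_formRep_skew hO (v 1)] at c
  rw [Fin.sum_univ_three]
  refine (congrArg (· - _) z).trans ?_
  simp [Fin.removeNth, Fin.succAbove, hl']
  -- In d(Tr(A) Ω) = d(Tr A) ∧ Ω + Tr(A) dΩ the last term vanishes.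
  linear_combination LinearMap.trace ℝ (TangentSpace 𝓘(ℝ, E) x) (sharpFlat π Ω x) * c

/-- With σ = Tr(π^♯Ω^♭), Δ_π(Ω ∧ Ω) contributes dσ ∧ Ω, while Δ_π Ω = ½ dσ, so the two correction
terms of Koszul's formula cancel it exactly and only the insertion term survives. -/
theorem koszulBracket_self_chartC (hπ : ∀ x, (π x).IsAlt) (hΩ : extD Ω = 0)
    (hO : HasChartDeriv (formRep x Ω) dO x)
    (hA : HasChartDeriv (endRep x (sharpFlat π Ω)) dA x) (v : Fin 3 → E) :
    koszulBracket π (p := 1) (q := 1) Ω Ω x (fun i => chartC x x (v i))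
      = -extD (iEnd (sharpFlat π Ω) Ω) x (fun i => chartC x x (v i)) := by
  have h1 := koszulDelta_wedge_self_chartC hπ hΩ hO hA v
  have d : ∀ a : E, koszulDelta π (p := 1) Ω x ![chartC x x a] = (1 / 2) * traceL E (dA a) :=
    fun a => by
      refine Eq.trans (congrArg _ ?_) (koszulDelta_two_chartC hπ hΩ hA ![a])
      ext i
      fin_cases i
      rfl
  have h2 := wedgeAlt_one_two (koszulDelta π (p := 1) Ω x) (Ω x) (fun i => chartC x x (v i))
  have h3 := wedgeAlt_two_one (Ω x) (koszulDelta π (p := 1) Ω x) (fun i => chartC x x (v i))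
  simp only [d, ← formRep_apply] at h2 h3
  have e : koszulBracket π (p := 1) (q := 1) Ω Ω x (fun i => chartC x x (v i))
      = (-1 : ℝ) ^ 2 * (koszulDelta π (p := 3) (Ω.wedge Ω) x (fun i => chartC x x (v i))
        - wedgeAlt (koszulDelta π (p := 1) Ω x) (Ω x) (fun i => chartC x x (v i))
        - (-1 : ℝ) ^ 2 *
          wedgeAlt (Ω x) (koszulDelta π (p := 1) Ω x) (fun i => chartC x x (v i))) := rfl
  rw [e, h1, h2, h3]
  ring

/-- `φ_+ = -d(i_N Ω + ½ i_A Ω)` with `A = π^♯ Ω^♭`, for a closed 2-form `Ω`. -/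
theorem phiPlus_chartC (N : EndField E M) (hπ : ∀ x, (π x).IsAlt) (hΩ : extD Ω = 0)
    (hO : HasChartDeriv (formRep x Ω) dO x)
    (hA : HasChartDeriv (endRep x (sharpFlat π Ω)) dA x) (v : Fin 3 → E) :
    phiPlus π N Ω x (fun i => chartC x x (v i))
      = -extD (iEnd N Ω) x (fun i => chartC x x (v i))
        - (1 / 2) * extD (iEnd (sharpFlat π Ω) Ω) x (fun i => chartC x x (v i)) := by
  have h := koszulBracket_self_chartC hπ hΩ hO hA v
  have e : phiPlus π N Ω x (fun i => chartC x x (v i))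
      = insertEndAlt (N x) (extD Ω x) (fun i => chartC x x (v i))
        - extD (iEnd N Ω) x (fun i => chartC x x (v i))
        + (1 / 2) * koszulBracket π (p := 1) (q := 1) Ω Ω x (fun i => chartC x x (v i)) := rfl
  rw [e, h, hΩ, Pi.zero_apply, insertEndAlt_zero, AlternatingMap.zero_apply]
  ring

end Koszul

/-! ### The explicit torsion of N_+ and the Lenard–Magri chain -/

section Chain

open Filter Topology

variable {E : Type*} [NormedAddCommGroup E] [NormedSpace ℝ E]

theorem apply_pow_biv_skew {P : (E →L[ℝ] ℝ) →L[ℝ] E} {B : E →L[ℝ] E}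
    (skew : ∀ ξ η : E →L[ℝ] ℝ, η (P ξ) = -ξ (P η)) (comm : ∀ ξ, B (P ξ) = P (ξ.comp B))
    (n : ℕ) (ξ η : E →L[ℝ] ℝ) : η ((B ^ n) (P ξ)) = -ξ ((B ^ n) (P η)) := by
  induction n generalizing ξ with
  | zero => exact skew ξ η
  | succ n ih =>
    have h1 : (B ^ (n + 1)) (P ξ) = (B ^ n) (B (P ξ)) := by rw [pow_succ]; rfl
    have h2 : (B ^ (n + 1)) (P η) = B ((B ^ n) (P η)) := by rw [pow_succ']; rfl
    rw [h1, comm, ih, h2]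
    rfl

variable [FiniteDimensional ℝ E]

theorem traceL_apply (B : E →L[ℝ] E) : traceL E B = LinearMap.trace ℝ E B.toLinearMap := rfl

theorem traceL_mul_comm (A B : E →L[ℝ] E) : traceL E (A * B) = traceL E (B * A) :=
  LinearMap.trace_mul_comm ℝ A.toLinearMap B.toLinearMap

variable {M : Type*} [TopologicalSpace M] [ChartedSpace E M] [IsManifold 𝓘(ℝ, E) ∞ M]

theorem endRep_mul {x z : M} (hz : z ∈ (chartAt E x).source) (B C : EndField E M) :
    endRep x (B * C) z = endRep x B z * endRep x C z := by
  ext v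
  exact (endRep_chartD hz B _).symm

theorem endRep_pow {x z : M} (hz : z ∈ (chartAt E x).source) (B : EndField E M) (k : ℕ) :
    endRep x (B ^ k) z = endRep x B z ^ k := by
  induction k with
  | zero => ext v; exact chartD_chartC hz v
  | succ k ih => rw [pow_succ, endRep_mul hz, ih, pow_succ]

theorem endRep_add (x z : M) (B C : EndField E M) :
    endRep x (B + C) z = endRep x B z + endRep x C z := by
  ext v
  exact map_add (chartD x z) _ _

theorem hasChartDeriv_traceH {x : M} {B : EndField E M} {dB : E →L[ℝ] E →L[ℝ] E}
    (hB : HasChartDeriv (endRep x B) dB x) (k : ℕ) :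
    ∃ g : E →L[ℝ] ℝ, HasChartDeriv (traceH B (k + 1)) g x ∧
      ∀ u, g u = (1 / 2) * traceL E (endRep x B x ^ k * dB u) := by
  have h1 : HasChartDeriv (fun z => endRep x B z ^ (k + 1)) _ x := HasFDerivAt.fun_pow' hB (k + 1)
  simp only [extChartAt_to_inv] at h1
  have h2 := (h1.clm (traceL E)).const_mul (1 / (2 * ((k + 1 : ℕ) : ℝ)))
  refine ⟨_, h2.congr ?_, fun u => ?_⟩
  · filter_upwards [eventually_mem_chart_source (H := E) x] with z hz
    rw [traceH, trace_pow_eq_traceL hz]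
  -- By cyclicity the k + 1 terms of the derivative of the power have equal traces, and their number
  -- cancels the normalisation of H_{k+1}, leaving ½.
  · have e : ∀ i ∈ Finset.range (k + 1), traceL E
        (endRep x B x ^ (k - i) * (dB u * endRep x B x ^ i))
        = traceL E (endRep x B x ^ k * dB u) := fun i hi => by
      rw [← mul_assoc, traceL_mul_comm, ← mul_assoc, ← pow_add,
        Nat.add_sub_cancel' (Finset.mem_range_succ_iff.1 hi)]
    have e' := Finset.sum_congr rfl e
    rw [Finset.sum_const, Finset.card_range, nsmul_eq_mul] at e'
    simp [_root_.sum_apply, mul_assoc]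
    rw [e']
    push_cast
    field_simp

theorem hamX_chartD {x : M} {π : BivField E M} {B : EndField E M} {k : ℕ} {g : E →L[ℝ] ℝ}
    (hg : HasChartDeriv (traceH B k) g x) : chartD x x (hamX π B k x) = bivRep x π x g := by
  rw [hamX, chartD_sharp (mem_chart_source E x)]
  congr 1
  ext v
  exact dFun_chartC hg v

/-- The trace of `B^n T(u, ·)` when `T(u, v) = -2 (h(u) A v - h(v) A u + O(u, v) P h)` and
`A = P O`. -/
theorem trace_pow_mul_wedge {P : (E →L[ℝ] ℝ) →L[ℝ] E} {O : E →L[ℝ] E →L[ℝ] ℝ} {B : E →L[ℝ] E}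
    (skew : ∀ ξ η : E →L[ℝ] ℝ, η (P ξ) = -ξ (P η)) (comm : ∀ ξ, B (P ξ) = P (ξ.comp B))
    (h : E →L[ℝ] ℝ) (n : ℕ) (u : E) (T : Module.End ℝ E)
    (hT : ∀ v, T v = (-2 : ℝ) • (h u • P (O v) - h v • P (O u) + O u v • P h)) :
    LinearMap.trace ℝ E (B.toLinearMap ^ n * T)
      = -2 * (h u * traceL E (B ^ n * P.comp O) + 2 * O u ((B ^ n) (P h))) := by
  have e : B.toLinearMap ^ n * T = (-2 : ℝ) • (h u • (B ^ n * P.comp O).toLinearMap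
      - h.toLinearMap.smulRight ((B ^ n) (P (O u)))
      + (O u).toLinearMap.smulRight ((B ^ n) (P h))) := by
    rw [← ContinuousLinearMap.toLinearMap_pow]
    generalize B ^ n = C
    ext v
    simp [hT]
  rw [e]
  simp only [map_smul, map_add, map_sub, LinearMap.trace_smulRight, ← traceL_apply, smul_eq_mul]
  have := apply_pow_biv_skew skew comm n (O u) h
  simp only [ContinuousLinearMap.coe_coe]
  rw [this]
  ring

/-- N commutes with π^♯ by compatibility. For π^♯Ω^♭, skew-symmetry of π and Ω gives the transpose
Ω^♭π^♯, and both sides become π^♯Ω^♭π^♯. -/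
theorem Nminus_sharp {π : BivField E M} {N : EndField E M} (hPN : IsPN π N) (Ω : Form E M 2)
    (x : M) (α : Module.Dual ℝ (TangentSpace 𝓘(ℝ, E) x)) :
    Nminus π N Ω x (sharp (π x) α) = sharp (π x) ((Nminus π N Ω x).dualMap α) := by
  have h1 := congrArg (fun l => l α) (hPN.compatible.comm x)
  have h2 : (sharpFlat π Ω x).dualMap α = flat (Ω x) (sharp (π x) α) := by
    ext w
    rw [LinearMap.dualMap_apply, sharpFlat, LinearMap.comp_apply,
      sharp_skew (hPN.poisson.alt x), flat_apply, flat_apply, ← alt_two_swap]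
  have h3 : (Nminus π N Ω x).dualMap α = (N x).dualMap α - (sharpFlat π Ω x).dualMap α := by
    ext w
    exact map_sub α _ _
  rw [h3, map_sub, h2]
  exact congrArg (· - _) h1

variable [T2Space M] {π : BivField E M} {N : EndField E M} {Ω : Form E M 2}

/-- The torsion of `N_+` at a point, in terms of the derivative of `N_+` in a chart. -/
theorem torsion_Nplus (hPN : IsPN π N) (hΩ : SmoothForm Ω) (hΩd : extD Ω = 0)
    (ha : phiPlus π N Ω
      = (-2 : ℝ) • Form.wedge (dFun E (traceH (Nplus π N Ω) 1)).toForm Ω) (x : M) :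
    (∀ ξ, endRep x (Nplus π N Ω) x (bivRep x π x ξ)
      = bivRep x π x (ξ.comp (endRep x (Nplus π N Ω) x))) ∧
    ∃ dB : E →L[ℝ] E →L[ℝ] E, HasChartDeriv (endRep x (Nplus π N Ω)) dB x ∧
      ∀ h : E →L[ℝ] ℝ, HasChartDeriv (traceH (Nplus π N Ω) 1) h x → ∀ u v,
        dB (endRep x (Nplus π N Ω) x u) v - dB (endRep x (Nplus π N Ω) x v) u
          - endRep x (Nplus π N Ω) x (dB u v) + endRep x (Nplus π N Ω) x (dB v u)
        = (-2 : ℝ) • (h u • bivRep x π x (formRep x Ω x v) - h v • bivRep x π x (formRep x Ω x u)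
          + formRep x Ω x u v • bivRep x π x h) := by
  have hx := mem_chart_source E x
  obtain ⟨dP, hP⟩ := hPN.poisson.smooth.exists_hasChartDeriv x
  obtain ⟨dO, hO⟩ := hΩ.exists_hasChartDeriv x
  obtain ⟨dN, hN⟩ := hPN.smooth.exists_hasChartDeriv x
  have hA := (hP.clm_comp hO).congr (g := endRep x (sharpFlat π Ω)) (by
    filter_upwards [eventually_mem_chart_source (H := E) x] with z hz
    exact endRep_sharpFlat hz π Ω)
  have jet := hPN.compatibleJet hΩd hP hO hN
  have alt := hPN.poisson.alt
  have dskew := hPN.poisson.deriv_bivRep_skew hP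
  have jac := hPN.poisson.deriv_bivRep_jacobi hP
  have tor := hPN.deriv_endRep_torsion hN
  generalize hdA : (ContinuousLinearMap.compL ℝ E (E →L[ℝ] ℝ) E (bivRep x π x)).comp dO
    + ((ContinuousLinearMap.compL ℝ E (E →L[ℝ] ℝ) E).flip (formRep x Ω x)).comp dP = dA at hA
  have hdA' : (fun u v => dA u v) = fun u v => dP u (formRep x Ω x v) + bivRep x π x (dO u v) := by
    funext u v
    simp [← hdA, add_comm]
  have hB : HasChartDeriv (endRep x (Nplus π N Ω)) (dN + dA) x :=
    (hN.add hA).congr (Eventually.of_forall fun z => endRep_add x z N (sharpFlat π Ω))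
  have eA := endRep_sharpFlat hx π Ω
  refine ⟨fun ξ => ?_, dN + dA, hB, fun h hh u v => ?_⟩
  · have c1 := jet.comm ξ
    have c2 := (jet.comp_form dskew jac).comm ξ
    rw [Nplus, endRep_add, eA, ContinuousLinearMap.comp_add, map_add, ← c1, ← c2]
    rfl
  · rw [SeparatingDual.eq_iff_forall_dual_eq (R := ℝ)]
    intro ζ
    have key := jet.torsion_add dskew jac (map_add dP) (map_add dO)
      (fun u v w => by rw [map_add]; rfl) tor _ eA _ hdA' u v ζ
    -- The torsion paired with ζ is minus φ_+ with π^♯ζ in its last slot, and (a') evaluates φ_+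
    -- there.
    have p := phiPlus_chartC N alt hΩd hO hA ![u, v, bivRep x π x ζ]
    rw [extD_iEnd hO hN, extD_iEnd hO hA, ha] at p
    have w := wedgeAlt_one_two ((dFun E (traceH (Nplus π N Ω) 1)).toForm x) (Ω x)
      (fun i => chartC x x (![u, v, bivRep x π x ζ] i))
    have d : ∀ a, (dFun E (traceH (Nplus π N Ω) 1)).toForm x ![chartC x x a] = h a :=
      fun a => dFun_chartC hh a
    simp only [d, ← formRep_apply] at w
    have p' := (congrArg ((-2 : ℝ) * ·) w).symm.trans p
    have s1 := jet.skew (formRep x Ω x v) ζ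
    have s2 := jet.skew (formRep x Ω x u) ζ
    have s3 := jet.skew h ζ
    simp only [Matrix.cons_val_zero, Matrix.cons_val_one, Matrix.cons_val] at p'
    rw [Nplus, endRep_add]
    simp only [map_smul, map_add, map_sub, smul_eq_mul, _root_.add_apply] at key ⊢
    linear_combination key + p' + 2 * h u * s1 - 2 * h v * s2 + 2 * formRep x Ω x u v * s3

theorem lenard_recursion (hPN : IsPN π N) (hΩ : SmoothForm Ω) (hΩd : extD Ω = 0)
    (ha : phiPlus π N Ω
      = (-2 : ℝ) • Form.wedge (dFun E (traceH (Nplus π N Ω) 1)).toForm Ω)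
    (hb : ∀ k : ℕ, 1 ≤ k → ∀ x : M, flat (Ω x) (vecY π (Nplus π N Ω) k x) = 0) (n : ℕ) (x : M) :
    (Nminus π N Ω x).dualMap (dFun E (traceH (Nplus π N Ω) (n + 1)) x)
      = dFun E (traceH (Nplus π N Ω) (n + 2)) x
        + (-LinearMap.trace ℝ (TangentSpace 𝓘(ℝ, E) x) (Nplus π N Ω x ^ n * sharpFlat π Ω x))
          • dFun E (traceH (Nplus π N Ω) 1) x := by
  have hx := mem_chart_source E x
  obtain ⟨comm, dB, hB, tor⟩ := torsion_Nplus hPN hΩ hΩd ha x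
  have skew := bivRep_skew hPN.poisson.alt x x
  obtain ⟨h, hh, -⟩ := hasChartDeriv_traceH hB 0
  obtain ⟨g, hg, hgB⟩ := hasChartDeriv_traceH hB n
  obtain ⟨g', hg', hgB'⟩ := hasChartDeriv_traceH hB (n + 1)
  have hf : LinearMap.trace ℝ (TangentSpace 𝓘(ℝ, E) x) (Nplus π N Ω x ^ n * sharpFlat π Ω x)
      = traceL E (endRep x (Nplus π N Ω) x ^ n * (bivRep x π x).comp (formRep x Ω x)) := by
    have := trace_pow_eq_traceL hx ((Nplus π N Ω) ^ n * sharpFlat π Ω) 1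
    rw [pow_one, pow_one, endRep_mul hx, endRep_pow hx, endRep_sharpFlat hx] at this
    exact this
  ext w
  obtain ⟨u, rfl⟩ : ∃ u, w = chartC x x u := ⟨_, (chartC_chartD hx w).symm⟩
  let B := endRep x (Nplus π N Ω) x
  let D : E →ₗ[ℝ] E →ₗ[ℝ] E := ContinuousLinearMap.coeLM ℝ ∘ₗ dB.toLinearMap
  let T : Module.End ℝ E := D (B u) - D.flip u * B.toLinearMap - B.toLinearMap * D u
    + B.toLinearMap * D.flip u
  have t1 : LinearMap.trace ℝ E (B.toLinearMap ^ n * T)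
      = LinearMap.trace ℝ E (B.toLinearMap ^ n * D (B u))
        - LinearMap.trace ℝ E (B.toLinearMap ^ (n + 1) * D u) :=
    trace_pow_mul_torsion B.toLinearMap D u T (fun v => rfl) n
  have t2 : LinearMap.trace ℝ E (B.toLinearMap ^ n * T)
      = -2 * (h u * traceL E (B ^ n * (bivRep x π x).comp (formRep x Ω x))
        + 2 * formRep x Ω x u ((B ^ n) (bivRep x π x h))) :=
    trace_pow_mul_wedge skew comm h n u T (fun v => tor h hh u v)
  have t3 : LinearMap.trace ℝ E (B.toLinearMap ^ n * D (B u)) = 2 * g (B u) := by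
    rw [hgB, ← ContinuousLinearMap.toLinearMap_pow]
    change traceL E (B ^ n * dB (B u)) = _
    ring
  have t4 : LinearMap.trace ℝ E (B.toLinearMap ^ (n + 1) * D u) = 2 * g' u := by
    rw [hgB', ← ContinuousLinearMap.toLinearMap_pow]
    change traceL E (B ^ (n + 1) * dB u) = _
    ring
  -- Condition (b') at k = n + 1: B^n X_1 and X_{n+1} differ by a vector in the kernel of Ω^♭.
  have y : formRep x Ω x u ((B ^ n) (bivRep x π x h)) = formRep x Ω x u (bivRep x π x g) := by
    have b := congrArg (fun l => l (chartC x x u)) (hb (n + 1) (by omega) x)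
    have v1 : vecY π (Nplus π N Ω) (n + 1) x
        = chartC x x ((B ^ n) (bivRep x π x h) - bivRep x π x g) := by
      rw [← hamX_chartD hh, ← hamX_chartD hg, ← endRep_pow hx, endRep_chartD hx, ← map_sub,
        chartC_chartD hx]
      rfl
    have b' : formRep x Ω x ((B ^ n) (bivRep x π x h) - bivRep x π x g) u = 0 := by
      rw [formRep_apply, ← v1]
      exact b
    rw [formRep_skew, map_sub] at b'
    linarith
  -- N_- = N_+ - 2π^♯Ω^♭; the extra term will cancel the Ω term left by the trace identity.
  have m : Nminus π N Ω x (chartC x x u)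
      = chartC x x (B u - 2 • bivRep x π x (formRep x Ω x u)) := by
    have := endRep_sharpFlat hx π Ω
    rw [← chartC_chartD hx (Nminus π N Ω x (chartC x x u))]
    congr 1
    have e : bivRep x π x (formRep x Ω x u) = endRep x (sharpFlat π Ω) x u := by rw [this]; rfl
    have e' : B u = endRep x N x u + endRep x (sharpFlat π Ω) x u := by
      change endRep x (Nplus π N Ω) x u = _
      rw [Nplus, endRep_add]; rfl
    rw [e, e', endRep_apply, endRep_apply, ← map_add, ← map_nsmul, ← map_sub]
    congr 1
    change N x _ - sharpFlat π Ω x _ = _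
    rw [two_nsmul]
    abel
  -- Moves π^♯ from Ω^♭u to dH_{n+1}, producing Ω(u, X_{n+1}) with the sign needed for that
  -- cancellation.
  have s := skew (formRep x Ω x u) g
  rw [LinearMap.dualMap_apply, m, dFun_chartC hg, LinearMap.add_apply, LinearMap.smul_apply,
    dFun_chartC hg', dFun_chartC hh, hf, map_sub, map_nsmul, s, smul_eq_mul]
  rw [t1, t3, t4, y] at t2
  change _ = g' u + -traceL E (B ^ n * (bivRep x π x).comp (formRep x Ω x)) * h u
  simp only [nsmul_eq_mul]
  push_cast
  linear_combination (1 / 2) * t2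

end Chain

end PqN

end

/-! ### The theorem: chain and involution -/

open PqN in
theorem theorem4p2
    {E : Type*} [NormedAddCommGroup E] [NormedSpace ℝ E] [FiniteDimensional ℝ E]
    {M : Type*} [TopologicalSpace M] [ChartedSpace E M] [IsManifold 𝓘(ℝ, E) ∞ M]
    [T2Space M] [SecondCountableTopology M]
    (π : BivField E M) (N : EndField E M) (hPN : IsPN π N)
    (Ω : Form E M 2) (hΩ : SmoothForm Ω) (hΩd : extD Ω = 0)
    (ha : phiPlus π N Ω
      = (-2 : ℝ) • Form.wedge (dFun E (traceH (Nplus π N Ω) 1)).toForm Ω)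
    (hb : ∀ k : ℕ, 1 ≤ k → ∀ x : M, flat (Ω x) (vecY π (Nplus π N Ω) k x) = 0) :
    (∀ k : ℕ, 1 ≤ k → ∀ x : M,
      (Nminus π N Ω x).dualMap (dFun E (traceH (Nplus π N Ω) k) x)
        = dFun E (traceH (Nplus π N Ω) (k + 1)) x
          + (-LinearMap.trace ℝ (TangentSpace 𝓘(ℝ, E) x)
              (Nplus π N Ω x ^ (k - 1) * sharpFlat π Ω x))
            • dFun E (traceH (Nplus π N Ω) 1) x) ∧
    (∀ j k : ℕ, 1 ≤ j → 1 ≤ k →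
      poissonBracket π (traceH (Nplus π N Ω) j) (traceH (Nplus π N Ω) k) = 0) := by
  have chain : ∀ k : ℕ, 1 ≤ k → ∀ x : M,
      (Nminus π N Ω x).dualMap (dFun E (traceH (Nplus π N Ω) k) x)
        = dFun E (traceH (Nplus π N Ω) (k + 1)) x
          + (-LinearMap.trace ℝ (TangentSpace 𝓘(ℝ, E) x)
              (Nplus π N Ω x ^ (k - 1) * sharpFlat π Ω x))
            • dFun E (traceH (Nplus π N Ω) 1) x := by
    intro k hk x
    obtain ⟨n, rfl⟩ := Nat.exists_eq_add_of_le' hk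
    exact lenard_recursion hPN hΩ hΩd ha hb n x
  refine ⟨chain, fun j k hj hk => funext fun x => ?_⟩
  refine eq_zero_of_lenard_recursion
    (fun j k => poissonBracket π (traceH (Nplus π N Ω) j) (traceH (Nplus π N Ω) k) x)
    (fun k => -LinearMap.trace ℝ (TangentSpace 𝓘(ℝ, E) x)
      (Nplus π N Ω x ^ (k - 1) * sharpFlat π Ω x))
    (fun j k => sharp_skew (hPN.poisson.alt x) _ _) (fun j k hj hk => ?_) j k hj hk
  -- The number dH_j(N_- X_k) is computed twice: `h1` moves N_- through π^♯ onto dH_k, `h2`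
  -- transposes it onto dH_j.
  have h1 := congrArg (dFun E (traceH (Nplus π N Ω) j) x)
    (Nminus_sharp hPN Ω x (dFun E (traceH (Nplus π N Ω) k) x))
  have h2 := congrArg (fun α => α (sharp (π x) (dFun E (traceH (Nplus π N Ω) k) x))) (chain j hj x)
  rw [chain k hk, map_add, map_smul, map_add, map_smul] at h1
  rw [LinearMap.dualMap_apply, LinearMap.add_apply, LinearMap.smul_apply] at h2
  exact h2.symm.trans h1
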